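/- Let $d\ge 2$ and let $\mathcal M_d$ be the algebra of complex $d\times d$ matrices. A Liouvillian is a linear map of the form $\mathcal L(f)=i[H,f]+\sum_i\big(L_i^\dagger fL_i-\tfrac12\{L_i^\dagger L_i,f\}\big)$ on $\mathcal M_d$ with $H=H^\dagger$ and finitely many $L_i\in\mathcal M_d$; put $T_t=e^{t\mathcal L}$ for $t\ge0$, and write $\Phi^*$ for the dual of a linear map $\Phi$ with respect to the Hilbert–Schmidt inner product. A state is a positive semidefinite matrix of trace one. $\mathcal L$ is primitive if it has a unique stationary state $\sigma$ ($\mathcal L^*(\sigma)=0$) and $\sigma$ has full rank. For such $\sigma$ and real $r$ let $\Gamma_\sigma^r(f)=\sigma^{r/2}f\sigma^{r/2}$, $\langle f,g\rangle_\sigma=\operatorname{tr}(\Gamma_\sigma(f)g)$, $\|f\|_{2,\sigma}^2=\langle f,f\rangle_\sigma$, $I_{p,q}(f)=\Gamma_\sigma^{-1/p}\big(|\Gamma_\sigma^{1/q}(f)|^{q/p}\big)$, $\operatorname{Var}_\sigma(g)=\langle g,g\rangle_\sigma-(\operatorname{tr}\Gamma_\sigma(g))^2$, $\chi^2(\rho,\sigma)=\operatorname{tr}\big((\rho-\sigma)\Gamma_\sigma^{-1}(\rho-\sigma)\big)$,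 and, with $X=\Gamma_\sigma^{1/2}(f)$, $$\operatorname{Ent}_2(f)=\operatorname{tr}(X^2\log X)-\tfrac12\operatorname{tr}(X^2\log\sigma)-\tfrac12\|f\|_{2,\sigma}^2\log\|f\|_{2,\sigma}^2 .$$ The Dirichlet forms are $\mathcal E_2(f)=-\langle f,\mathcal L(f)\rangle_\sigma$ and, for $p>1$, $1/p+1/q=1$ and $f$ positive definite, $\mathcal E_p(f)=-\frac{p}{2(p-1)}\langle I_{q,p}(f),\mathcal L(f)\rangle_\sigma$. $\mathcal L$ is strongly $\mathbb L_p$-regular if $\mathcal E_p(f)\ge\frac2p\,\mathcal E_2(I_{2,p}(f))$ for all $p>1$ and all positive definite $f$. The $LS_2$ constant $\alpha_2$ is the largest $\alpha>0$ with $\alpha\operatorname{Ent}_2(f)\le\mathcal E_2(f)$ for all positive definite $f$ (we assume that one exists), and the spectral gap is $\lambda=\min\{\mathcal E_2(g)/\operatorname{Var}_\sigma(g): g=g^\dagger,\ \operatorname{Var}_\sigma(g)\ne0\}$. Let $\sigma_{\min}$ be the smallest eigenvalue of $\sigma$. **Proposition.** Let $\mathcal L$ be a primitive, strongly $\mathbb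 L_p$-regular Liouvillian with stationary state $\sigma$, $LS_2$ constant $\alpha_2$ and spectral gap $\lambda$. Then for every $c>0$, every $t\ge0$ with $$t\ \ge\ \frac1{2\alpha_2}\log\log\frac1{\sigma_{\min}}+\frac c\lambda ,$$ and every state $\rho$, $$\chi^2\big(T_t^*(\rho),\sigma\big)\le e^{2(1-c)} .$$ -/

import Mathlib

/-! Quantum Markov semigroups on the `d × d` complex matrices and their weighted
non-commutative `L_p` quantities, for a full-rank reference state `σ`. -/

namespace QMS

open scoped ComplexOrder

noncomputable section

/-- The algebra of complex `d × d` matrices. -/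
abbrev Mat (d : ℕ) : Type := Matrix (Fin d) (Fin d) ℂ

/-- Linear maps on matrices. -/
abbrev SuperOp (d : ℕ) : Type := Mat d →ₗ[ℂ] Mat d

/-- States: positive semidefinite matrices of trace one. -/
def IsState {d : ℕ} (ρ : Mat d) : Prop := ρ.PosSemidef ∧ ρ.trace = 1

/-- The right-hand side of the Lindblad equation in the Heisenberg picture,
`i[H,f] + ∑ᵢ (Lᵢ† f Lᵢ - ½ {Lᵢ† Lᵢ, f})`. -/
def lindblad {d k : ℕ} (H : Mat d) (L : Fin k → Mat d) (f : Mat d) : Mat d :=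
  Complex.I • (H * f - f * H) +
    ∑ i, ((L i).conjTranspose * f * L i -
      (1 / 2 : ℂ) • ((L i).conjTranspose * L i * f + f * ((L i).conjTranspose * L i)))

/-- A Liouvillian is a generator in Lindblad form, with Hermitian Hamiltonian and finitely many
Lindblad operators. -/
def IsLiouvillian {d : ℕ} (𝓛 : SuperOp d) : Prop :=
  ∃ (H : Mat d) (k : ℕ) (L : Fin k → Mat d), H.IsHermitian ∧ ∀ f, 𝓛 f = lindblad H L f

/-- The dual of a linear map with respect to the Hilbert–Schmidt inner product
`⟨A, B⟩ = tr (A† B)`; see `trace_hsDual`. -/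
def hsDual {d : ℕ} (Φ : SuperOp d) : SuperOp d where
  toFun ρ := Matrix.of fun i j => ((Φ (Matrix.single i j 1)).conjTranspose * ρ).trace
  map_add' ρ τ := by
    ext i j
    simp [Matrix.mul_add]
  map_smul' a ρ := by
    ext i j
    simp

theorem trace_hsDual {d : ℕ} (Φ : SuperOp d) (f ρ : Mat d) :
    (f.conjTranspose * hsDual Φ ρ).trace = ((Φ f).conjTranspose * ρ).trace := by
  have h : Φ f = ∑ i, ∑ j, f i j • Φ (Matrix.single i j 1) := by
    conv_lhs => rw [Matrix.matrix_eq_sum_single f]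
    simp only [map_sum]
    refine Finset.sum_congr rfl fun i _ => Finset.sum_congr rfl fun j _ => ?_
    rw [← map_smul, Matrix.smul_single, smul_eq_mul, mul_one]
  rw [h]
  simp only [Matrix.conjTranspose_sum, Matrix.conjTranspose_smul, Matrix.sum_mul,
    Matrix.trace_sum, Matrix.smul_mul, Matrix.trace_smul]
  rw [Matrix.trace]
  simp only [Matrix.diag, Matrix.mul_apply, Matrix.conjTranspose_apply, hsDual,
    LinearMap.coe_mk, AddHom.coe_mk, Matrix.of_apply, smul_eq_mul]
  rw [Finset.sum_comm]

/-- The semigroup `T_t = exp (t 𝓛)` in the Heisenberg picture: the matrix exponential of the matrix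
of `t 𝓛` in the basis of matrix units. -/
def semigroup {d : ℕ} (𝓛 : SuperOp d) (t : ℝ) : SuperOp d :=
  Matrix.toLin (Matrix.stdBasis ℂ (Fin d) (Fin d)) (Matrix.stdBasis ℂ (Fin d) (Fin d))
    (NormedSpace.exp ((t : ℂ) • LinearMap.toMatrix (Matrix.stdBasis ℂ (Fin d) (Fin d))
      (Matrix.stdBasis ℂ (Fin d) (Fin d)) 𝓛))

/-- `𝓛` is primitive with stationary state `σ`: the state `σ` has full rank, `𝓛* σ = 0`, and `σ` is
the only stationary state. -/
def IsPrimitive {d : ℕ} (𝓛 : SuperOp d) (σ : Mat d) : Prop :=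
  σ.PosDef ∧ σ.trace = 1 ∧ hsDual 𝓛 σ = 0 ∧ ∀ ρ, IsState ρ → hsDual 𝓛 ρ = 0 → ρ = σ

/-- Real powers of a positive definite matrix, by functional calculus. -/
def rpow {d : ℕ} (σ : Mat d) (s : ℝ) : Mat d := cfc (fun x : ℝ => x ^ s) σ

/-- `|X|^s` for a Hermitian matrix `X`, by functional calculus. -/
def absPow {d : ℕ} (X : Mat d) (s : ℝ) : Mat d := cfc (fun x : ℝ => |x| ^ s) X

/-- The logarithm of a positive definite matrix, by functional calculus. -/
def logm {d : ℕ} (X : Mat d) : Mat d := cfc Real.log X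

/-- The smallest eigenvalue of a Hermitian matrix. -/
def minEigenvalue {d : ℕ} (σ : Mat d) : ℝ := sInf (spectrum ℝ σ)

/-- The powers `Γ_σ^r (f) = σ^{r/2} f σ^{r/2}` of the weighting map. -/
def gam {d : ℕ} (σ : Mat d) (r : ℝ) (f : Mat d) : Mat d := rpow σ (r / 2) * f * rpow σ (r / 2)

/-- The weighted inner product `⟨f, g⟩_σ = tr (Γ_σ(f) g)`, a real number for Hermitian `f`, `g`. -/
def wInner {d : ℕ} (σ f g : Mat d) : ℝ := (gam σ 1 f * g).trace.re

/-- The weighted norm `‖f‖_{p,σ} = (tr |Γ_σ^{1/p}(f)|^p)^{1/p}` of a Hermitian matrix. -/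
def wNorm {d : ℕ} (σ : Mat d) (p : ℝ) (f : Mat d) : ℝ :=
  (absPow (gam σ (1 / p) f) p).trace.re ^ (1 / p)

/-- The variance `Var_σ(g) = tr (Γ_σ(g) g) - (tr Γ_σ(g))²` of a Hermitian matrix. -/
def wVar {d : ℕ} (σ g : Mat d) : ℝ := (gam σ 1 g * g).trace.re - (gam σ 1 g).trace.re ^ 2

/-- The `L_p` power operator `I_{p,q}(f) = Γ_σ^{-1/p} (|Γ_σ^{1/q}(f)|^{q/p})`. -/
def powerOp {d : ℕ} (σ : Mat d) (p q : ℝ) (f : Mat d) : Mat d :=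
  gam σ (-(1 / p)) (absPow (gam σ (1 / q) f) (q / p))

/-- The `L_2` relative entropy of a positive definite matrix. -/
def ent₂ {d : ℕ} (σ f : Mat d) : ℝ :=
  (gam σ (1 / 2) f * gam σ (1 / 2) f * logm (gam σ (1 / 2) f)).trace.re
    - 1 / 2 * (gam σ (1 / 2) f * gam σ (1 / 2) f * logm σ).trace.re
    - 1 / 2 * wNorm σ 2 f ^ 2 * Real.log (wNorm σ 2 f ^ 2)

/-- The `L_2` Dirichlet form `𝓔₂(f) = -⟨f, 𝓛 f⟩_σ` of a Hermitian matrix. -/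
def dirichlet₂ {d : ℕ} (𝓛 : SuperOp d) (σ f : Mat d) : ℝ := -wInner σ f (𝓛 f)

/-- The `L_p` Dirichlet form `𝓔_p(f) = -p / (2 (p - 1)) ⟨I_{q,p}(f), 𝓛 f⟩_σ`, for `p > 1`,
`1/p + 1/q = 1` and `f` positive definite. -/
def dirichlet {d : ℕ} (𝓛 : SuperOp d) (σ : Mat d) (p : ℝ) (f : Mat d) : ℝ :=
  -p / (2 * (p - 1)) * wInner σ (powerOp σ (p / (p - 1)) p f) (𝓛 f)

/-- Strong `L_p`-regularity: `𝓔_p(f) ≥ (2/p) 𝓔₂(I_{2,p}(f))` for positive definite `f`.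
The case `p = 1`, where `𝓔₁` is by definition the limit of `𝓔_p` as `p ↓ 1`, follows from the
cases `p > 1` by passing to the limit. -/
def StronglyLpRegular {d : ℕ} (𝓛 : SuperOp d) (σ : Mat d) : Prop :=
  ∀ p : ℝ, 1 < p → ∀ f : Mat d, f.PosDef →
    2 / p * dirichlet₂ 𝓛 σ (powerOp σ 2 p f) ≤ dirichlet 𝓛 σ p f

/-- `α` is the `LS₂` constant: the largest positive `α` with `α Ent₂(f) ≤ 𝓔₂(f)` for all positive
definite `f`. -/
def IsLogSobolevConst₂ {d : ℕ} (𝓛 : SuperOp d) (σ : Mat d) (α : ℝ) : Prop :=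
  IsGreatest {a : ℝ | 0 < a ∧ ∀ f : Mat d, f.PosDef → a * ent₂ σ f ≤ dirichlet₂ 𝓛 σ f} α

/-- `r` is the spectral gap: the minimum of `𝓔₂(g) / Var_σ(g)` over the Hermitian `g` of nonzero
variance. -/
def IsSpectralGap {d : ℕ} (𝓛 : SuperOp d) (σ : Mat d) (r : ℝ) : Prop :=
  IsLeast {x : ℝ | ∃ g : Mat d, g.IsHermitian ∧ wVar σ g ≠ 0 ∧
    x = dirichlet₂ 𝓛 σ g / wVar σ g} r

/-- The divergence `χ²(ρ, σ) = tr ((ρ - σ) Γ_σ⁻¹(ρ - σ))`. -/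
def chiSq {d : ℕ} (ρ σ : Mat d) : ℝ := ((ρ - σ) * gam σ (-1) (ρ - σ)).trace.re

end

end QMS

/-! Write $l=\log(1/\sigma_{\min})$. The log-Sobolev inequality first brings $\chi^2$ below $e^2$;
the spectral gap then contracts it at rate $e^{-2\lambda t}$ during the remaining time $c/\lambda$.

The first phase rests on hypercontractivity: along $p(t)=1+e^{2\alpha_2t}$ the norm
$\|T_tf\|_{p(t),\sigma}$ does not increase (`hypercontractive`), because strong regularity turns the
$LS_2$ inequality for $I_{2,p}(f)$ into a bound on $\mathcal E_p(f)$. It yields a bound on $\chi^2$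
without reversibility, by a self-bounding argument (`chiSq_le_of_posDef`). Put
$h=\Gamma_\sigma^{-1}(T_T^*\rho)$ and $q=p(T)$. Then
$S=\|h\|_{2,\sigma}^2=\operatorname{tr}(T_T(h)\rho)\le\sigma_{\min}^{-1/q}\|T_Th\|_{q,\sigma}\le\sigma_{\min}^{-1/q}S^{1/2}$,
so $\chi^2=S-1\le e^{2l/q}$. At $T=\frac1{2\alpha_2}\log l$ one has $q=1+l$, and $2l/q\le2$.

This choice of $T$ needs $l\ge1$. Otherwise $\log l\le0$, the bound at time $0$ is $\chi^2\le e^l$,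
and the missing time $\frac1{2\alpha_2}|\log l|$ has to be paid for. This uses
$\lambda\le(2+l)\alpha_2$ (`spectralGap_le`), a consequence of
$\operatorname{Ent}_2\le(2+l)\operatorname{Var}_\sigma$ (`ent₂_bounds`), together with
$l\ge\log2>2/3$.

Two analytic points carry the rest. Positivity of $T_t$ comes from a barrier argument on the
Lindblad form (`semigroup_add_pos`). The noncommutative power $\operatorname{tr}X^p$ is never
differentiated in $X$: by convexity its tangent lies below it, and a lower tangent with nonpositive
slope at every point forces a continuous function to decrease (`le_of_lower_tangent`). -/

namespace QMS

open Matrix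
open scoped ComplexOrder

/-! ### Functional calculus, trace formulas and the weighting map -/

section Spectral

variable {d : ℕ} {A B σ X : Mat d}

theorem continuousOn_spectrum (A : Mat d) (f : ℝ → ℝ) : ContinuousOn f (spectrum ℝ A) :=
  (Matrix.finite_real_spectrum).continuousOn f

theorem isHermitian_cfc (f : ℝ → ℝ) (A : Mat d) : (cfc f A).IsHermitian :=
  IsSelfAdjoint.cfc (f := f) (a := A)

theorem cfc_mul_cfc (f g : ℝ → ℝ) (A : Mat d) :
    cfc f A * cfc g A = cfc (fun x => f x * g x) A :=
  (cfc_mul f g A (continuousOn_spectrum A f) (continuousOn_spectrum A g)).symm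

theorem cfc_cfc (hA : A.IsHermitian) (f g : ℝ → ℝ) : cfc g (cfc f A) = cfc (fun x => g (f x)) A :=
  (cfc_comp' g f A (((Matrix.finite_real_spectrum).image f).continuousOn g)
    (continuousOn_spectrum A f) hA).symm

theorem cfc_congr_pos (hA : A.PosDef) {f g : ℝ → ℝ} (h : ∀ x, 0 < x → f x = g x) :
    cfc f A = cfc g A := by
  refine cfc_congr fun x hx => h x ?_
  rw [hA.1.spectrum_real_eq_range_eigenvalues] at hx
  obtain ⟨i, rfl⟩ := hx
  exact hA.eigenvalues_pos i

theorem cfc_one_eq (hA : A.IsHermitian) : cfc (fun _ : ℝ => (1 : ℝ)) A = 1 := cfc_const_one ℝ A hA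

theorem cfc_id_eq (hA : A.IsHermitian) : cfc (fun x : ℝ => x) A = A := cfc_id' ℝ A hA

theorem posDef_cfc (hA : A.IsHermitian) {f : ℝ → ℝ} (h : ∀ i, 0 < f (hA.eigenvalues i)) :
    (cfc f A).PosDef := by
  rw [hA.cfc_eq, IsHermitian.cfc, Unitary.conjStarAlgAut_apply]
  have hU : IsUnit (hA.eigenvectorUnitary : Mat d) := (Unitary.toUnits hA.eigenvectorUnitary).isUnit
  rw [Matrix.IsUnit.posDef_star_right_conjugate_iff hU, Matrix.posDef_diagonal_iff]
  intro i
  simpa using h i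

theorem posSemidef_cfc (hA : A.IsHermitian) {f : ℝ → ℝ} (h : ∀ i, 0 ≤ f (hA.eigenvalues i)) :
    (cfc f A).PosSemidef := by
  rw [hA.cfc_eq, IsHermitian.cfc, Unitary.conjStarAlgAut_apply]
  have hU : IsUnit (hA.eigenvectorUnitary : Mat d) := (Unitary.toUnits hA.eigenvectorUnitary).isUnit
  rw [Matrix.IsUnit.posSemidef_star_right_conjugate_iff hU, Matrix.posSemidef_diagonal_iff]
  intro i
  simpa using h i

theorem cfc_const_eq (hA : A.IsHermitian) (m : ℝ) : cfc (fun _ : ℝ => m) A = (m : ℂ) • 1 := by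
  rw [cfc_const m A (show IsSelfAdjoint A from hA), Complex.coe_smul,
    Algebra.algebraMap_eq_smul_one]

theorem cfc_sub_const (hA : A.IsHermitian) (m : ℝ) :
    cfc (fun x : ℝ => x - m) A = A - (m : ℂ) • 1 := by
  rw [cfc_sub (fun x : ℝ => x) (fun _ => m) A (continuousOn_spectrum _ _)
    (continuousOn_spectrum _ _), cfc_id_eq hA, cfc_const_eq hA]

theorem cfc_const_sub (hA : A.IsHermitian) (m : ℝ) :
    cfc (fun x : ℝ => m - x) A = (m : ℂ) • 1 - A := by
  rw [cfc_sub (fun _ => m) (fun x : ℝ => x) A (continuousOn_spectrum _ _)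
    (continuousOn_spectrum _ _), cfc_id_eq hA, cfc_const_eq hA]

/-- The weights are $|\langle u_i,v_j\rangle|^2$ for the two eigenbases. They do not depend on $f$
and $g$, so a trace inequality for two noncommuting matrices reduces to a scalar inequality at each
pair of eigenvalues. -/
theorem exists_weights (hA : A.IsHermitian) (hB : B.IsHermitian) :
    ∃ w : Fin d → Fin d → ℝ, (∀ i j, 0 ≤ w i j) ∧ ∀ f g : ℝ → ℝ,
      (cfc f A * cfc g B).trace.re =
        ∑ i, ∑ j, f (hA.eigenvalues i) * g (hB.eigenvalues j) * w i j := by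
  set U : Mat d := hA.eigenvectorUnitary.1 with hU
  set V : Mat d := hB.eigenvectorUnitary.1 with hV
  refine ⟨fun i j => Complex.normSq ((star U * V) i j), fun i j => Complex.normSq_nonneg _,
    fun f g => ?_⟩
  rw [hA.cfc_eq, hB.cfc_eq, IsHermitian.cfc, IsHermitian.cfc, Unitary.conjStarAlgAut_apply,
    Unitary.conjStarAlgAut_apply, ← hU, ← hV]
  set D : Mat d := diagonal (RCLike.ofReal ∘ f ∘ hA.eigenvalues)
  set E : Mat d := diagonal (RCLike.ofReal ∘ g ∘ hB.eigenvalues)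
  have h : (U * D * star U * (V * E * star V)).trace =
      (D * (star U * V) * (E * star (star U * V))).trace := by
    rw [star_mul, star_star, Matrix.mul_assoc U, Matrix.mul_assoc U, Matrix.trace_mul_comm U]
    simp only [Matrix.mul_assoc]
  rw [h, Matrix.trace, Complex.re_sum]
  refine Finset.sum_congr rfl fun i _ => ?_
  rw [Matrix.diag_apply, Matrix.mul_apply, Complex.re_sum]
  refine Finset.sum_congr rfl fun j _ => ?_
  simp only [D, E, Matrix.diagonal_mul, Matrix.star_apply, Function.comp_apply]
  generalize (star U * V) i j = z
  simp [Complex.normSq_apply]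
  ring

theorem trace_cfc_re (hA : A.IsHermitian) (f : ℝ → ℝ) :
    (cfc f A).trace.re = ∑ i, f (hA.eigenvalues i) := by
  rw [hA.cfc_eq, IsHermitian.cfc, Unitary.conjStarAlgAut_apply, Matrix.trace_mul_comm,
    ← Matrix.mul_assoc]
  simp [Matrix.trace]

theorem isHermitian_rpow (σ : Mat d) (s : ℝ) : (rpow σ s).IsHermitian := isHermitian_cfc _ _

theorem posDef_rpow (hσ : σ.PosDef) (s : ℝ) : (rpow σ s).PosDef :=
  posDef_cfc hσ.1 fun i => Real.rpow_pos_of_pos (hσ.eigenvalues_pos i) s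

theorem rpow_mul_rpow (hσ : σ.PosDef) (a b : ℝ) : rpow σ a * rpow σ b = rpow σ (a + b) := by
  rw [rpow, rpow, rpow, cfc_mul_cfc]
  exact cfc_congr_pos hσ fun x hx => (Real.rpow_add hx a b).symm

theorem rpow_zero (hσ : σ.PosDef) : rpow σ 0 = 1 := by
  simp [rpow, cfc_one_eq hσ.1]

theorem rpow_one (hσ : σ.PosDef) : rpow σ 1 = σ := by
  simp [rpow, cfc_id_eq hσ.1]

theorem rpow_two (hσ : σ.PosDef) : rpow σ 2 = σ * σ := by
  rw [show (2 : ℝ) = 1 + 1 by norm_num, ← rpow_mul_rpow hσ, rpow_one hσ]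

theorem absPow_eq_rpow (hX : X.PosDef) (s : ℝ) : absPow X s = rpow X s :=
  cfc_congr_pos hX fun x hx => by rw [abs_of_pos hx]

theorem logm_rpow (hX : X.PosDef) (s : ℝ) : logm (rpow X s) = (s : ℂ) • logm X := by
  rw [logm, rpow, cfc_cfc hX.1, logm, Complex.coe_smul]
  rw [← cfc_smul s Real.log X (continuousOn_spectrum X _)]
  exact cfc_congr_pos hX fun x hx => by simp [Real.log_rpow hx]

theorem gam_gam (hσ : σ.PosDef) (a b : ℝ) (f : Mat d) : gam σ a (gam σ b f) = gam σ (a + b) f := by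
  simp only [gam]
  rw [show rpow σ (a / 2) * (rpow σ (b / 2) * f * rpow σ (b / 2)) * rpow σ (a / 2) =
    (rpow σ (a / 2) * rpow σ (b / 2)) * f * (rpow σ (b / 2) * rpow σ (a / 2)) by
      simp only [Matrix.mul_assoc], rpow_mul_rpow hσ, rpow_mul_rpow hσ]
  ring_nf

theorem gam_zero (hσ : σ.PosDef) (f : Mat d) : gam σ 0 f = f := by
  simp [gam, rpow_zero hσ]

theorem gam_neg_gam (hσ : σ.PosDef) (a : ℝ) (f : Mat d) : gam σ (-a) (gam σ a f) = f := by
  rw [gam_gam hσ, neg_add_cancel, gam_zero hσ]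

theorem gam_gam_neg (hσ : σ.PosDef) (a : ℝ) (f : Mat d) : gam σ a (gam σ (-a) f) = f := by
  rw [gam_gam hσ, add_neg_cancel, gam_zero hσ]

theorem isHermitian_gam {f : Mat d} (hf : f.IsHermitian) (r : ℝ) : (gam σ r f).IsHermitian := by
  have := Matrix.isHermitian_mul_mul_conjTranspose (rpow σ (r / 2)) hf
  rwa [(isHermitian_rpow σ (r / 2)).eq] at this

theorem posDef_gam {f : Mat d} (hσ : σ.PosDef) (hf : f.PosDef) (r : ℝ) : (gam σ r f).PosDef := by
  have h := hf.mul_mul_conjTranspose_same (B := rpow σ (r / 2))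
    (Matrix.vecMul_injective_of_isUnit (posDef_rpow hσ _).isUnit)
  rwa [(isHermitian_rpow σ (r / 2)).eq] at h

theorem trace_gam_mul (σ : Mat d) (r : ℝ) (f g : Mat d) :
    (gam σ r f * g).trace = (f * gam σ r g).trace := by
  simp only [gam]
  rw [Matrix.mul_assoc, Matrix.mul_assoc, Matrix.trace_mul_comm]
  simp only [Matrix.mul_assoc]

theorem gam_add (σ : Mat d) (r : ℝ) (f g : Mat d) : gam σ r (f + g) = gam σ r f + gam σ r g := by
  simp [gam, Matrix.mul_add, Matrix.add_mul]

theorem gam_sub (σ : Mat d) (r : ℝ) (f g : Mat d) : gam σ r (f - g) = gam σ r f - gam σ r g := by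
  simp [gam, Matrix.mul_sub, Matrix.sub_mul]

theorem gam_smul (σ : Mat d) (r : ℝ) (a : ℂ) (f : Mat d) : gam σ r (a • f) = a • gam σ r f := by
  simp [gam]

theorem gam_one_right (hσ : σ.PosDef) (r : ℝ) : gam σ r 1 = rpow σ r := by
  simp [gam, rpow_mul_rpow hσ]

end Spectral

/-! ### Entropy against variance, and the spectral gap against the log-Sobolev constant -/

section Entropy

theorem sq_mul_log_lower {u : ℝ} (hu : 0 < u) :
    1 / 2 * (u - 1) ^ 2 ≤ u ^ 2 * Real.log u - 1 / 2 * (u ^ 2 - 1) := by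
  have h := Real.one_sub_inv_le_log_of_pos hu
  have h2 : u ^ 2 * (1 - u⁻¹) ≤ u ^ 2 * Real.log u := mul_le_mul_of_nonneg_left h (sq_nonneg u)
  have h3 : u ^ 2 * (1 - u⁻¹) = u ^ 2 - u := by field_simp
  nlinarith

/-- The difference of the two sides vanishes at $1$ and has derivative $2((1+m)(x-1)-x\log x)$.
Between $1$ and $u$ this has the sign of $x-1$: for $x\ge1$, $x\log x=(x-1)\log x+\log
x\le(1+m)(x-1)$; for $x\le1$, $x\log x\ge x-1$. -/
theorem sq_mul_log_upper {u m : ℝ} (hu : 0 < u) (hm : 0 ≤ m) (h : Real.log u ≤ m) :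
    u ^ 2 * Real.log u - 1 / 2 * (u ^ 2 - 1) ≤ (1 + m) * (u - 1) ^ 2 := by
  set G : ℝ → ℝ := fun x => (1 + m) * (x - 1) ^ 2 - (x ^ 2 * Real.log x - 1 / 2 * (x ^ 2 - 1))
  have hG : ∀ x, 0 < x → HasDerivAt G (2 * ((1 + m) * (x - 1) - x * Real.log x)) x := by
    intro x hx
    have h1 := (((hasDerivAt_id x).sub_const 1).pow 2).const_mul (1 + m)
    have h2 := ((hasDerivAt_id x).pow 2).mul (Real.hasDerivAt_log hx.ne')
    have h3 := (((hasDerivAt_id x).pow 2).sub_const 1).const_mul (1 / 2 : ℝ)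
    refine (h1.sub (h2.sub h3)).congr_deriv ?_
    simp
    field_simp
    ring
  have hG1 : G 1 = 0 := by simp [G]
  suffices 0 ≤ G u by simp only [G] at this; linarith
  rw [← hG1]
  rcases le_total 1 u with h1 | h1
  · have hmono : MonotoneOn G (Set.Icc 1 u) := by
      refine monotoneOn_of_deriv_nonneg (convex_Icc 1 u)
        (fun x hx => (hG x (by linarith [hx.1])).continuousAt.continuousWithinAt)
        (fun x hx => ?_) (fun x hx => ?_)
      · rw [interior_Icc] at hx
        exact (hG x (by linarith [hx.1])).differentiableAt.differentiableWithinAt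
      · rw [interior_Icc] at hx
        have hx0 : 0 < x := by linarith [hx.1]
        rw [(hG x hx0).deriv]
        have e1 : Real.log x ≤ m := (Real.log_le_log hx0 hx.2.le).trans h
        have e2 := Real.log_le_sub_one_of_pos hx0
        nlinarith [hx.1]
    exact hmono ⟨le_rfl, h1⟩ ⟨h1, le_rfl⟩ h1
  · have hanti : AntitoneOn G (Set.Icc u 1) := by
      refine antitoneOn_of_deriv_nonpos (convex_Icc u 1)
        (fun x hx => (hG x (by linarith [hx.1])).continuousAt.continuousWithinAt)
        (fun x hx => ?_) (fun x hx => ?_)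
      · rw [interior_Icc] at hx
        exact (hG x (by linarith [hx.1])).differentiableAt.differentiableWithinAt
      · rw [interior_Icc] at hx
        have hx0 : 0 < x := by linarith [hx.1]
        rw [(hG x hx0).deriv]
        have e2 := mul_le_mul_of_nonneg_left (Real.one_sub_inv_le_log_of_pos hx0) hx0.le
        have e3 : x * (1 - x⁻¹) = x - 1 := by field_simp
        nlinarith [hx.2]
    exact hanti ⟨le_rfl, h1⟩ ⟨h1, le_rfl⟩ h1

theorem sq_mul_log_div_bounds {x z m : ℝ} (hx : 0 < x) (hz : 0 < z) (hm : 0 ≤ m)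
    (h : Real.log x - Real.log z ≤ m) :
    1 / 2 * (x - z) ^ 2 ≤ x ^ 2 * (Real.log x - Real.log z) - 1 / 2 * (x ^ 2 - z ^ 2) ∧
      x ^ 2 * (Real.log x - Real.log z) - 1 / 2 * (x ^ 2 - z ^ 2) ≤ (1 + m) * (x - z) ^ 2 := by
  have hu : 0 < x / z := div_pos hx hz
  rw [← Real.log_div hx.ne' hz.ne'] at h ⊢
  have h1 := mul_le_mul_of_nonneg_left (sq_mul_log_lower hu) (sq_nonneg z)
  have h2 := mul_le_mul_of_nonneg_left (sq_mul_log_upper hu hm h) (sq_nonneg z)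
  have e1 : z ^ 2 * (x / z) ^ 2 = x ^ 2 := by field_simp
  have e2 : z ^ 2 * (x / z - 1) ^ 2 = (x - z) ^ 2 := by field_simp
  constructor <;> nlinarith

variable {d : ℕ} {σ f g : Mat d}

theorem minEigenvalue_le (hσ : σ.IsHermitian) (i : Fin d) :
    minEigenvalue σ ≤ hσ.eigenvalues i :=
  csInf_le (Matrix.finite_real_spectrum).bddBelow (hσ.eigenvalues_mem_spectrum_real i)

theorem exists_eigenvalues_eq_minEigenvalue [Nonempty (Fin d)] (hσ : σ.IsHermitian) :
    ∃ i, hσ.eigenvalues i = minEigenvalue σ := by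
  have hne : (spectrum ℝ σ).Nonempty := by
    rw [hσ.spectrum_real_eq_range_eigenvalues]
    exact Set.range_nonempty _
  have h := hne.csInf_mem (Matrix.finite_real_spectrum)
  rw [hσ.spectrum_real_eq_range_eigenvalues] at h
  rwa [minEigenvalue, hσ.spectrum_real_eq_range_eigenvalues]

theorem minEigenvalue_pos [Nonempty (Fin d)] (hσ : σ.PosDef) : 0 < minEigenvalue σ := by
  obtain ⟨i, hi⟩ := exists_eigenvalues_eq_minEigenvalue hσ.1
  rw [← hi]
  exact hσ.eigenvalues_pos i

theorem nonempty_of_trace_eq_one (h : σ.trace = 1) : Nonempty (Fin d) := by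
  by_contra hc
  rw [not_nonempty_iff] at hc
  simp [Matrix.trace] at h

theorem sum_eigenvalues_eq_one (hσ : σ.IsHermitian) (h : σ.trace = 1) :
    ∑ i, hσ.eigenvalues i = 1 := by
  have := trace_cfc_re hσ (fun x => x)
  rw [cfc_id_eq hσ, h] at this
  simpa using this.symm

theorem dim_mul_minEigenvalue_le (hσ : σ.IsHermitian) (h : σ.trace = 1) :
    d * minEigenvalue σ ≤ 1 := by
  rw [← sum_eigenvalues_eq_one hσ h]
  simpa using Finset.card_nsmul_le_sum Finset.univ hσ.eigenvalues (minEigenvalue σ)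
    fun i _ => minEigenvalue_le hσ i

theorem trace_gam_one_mul_self (hσ : σ.PosDef) (f : Mat d) :
    (gam σ 1 f * f).trace = (gam σ (1 / 2) f * gam σ (1 / 2) f).trace := by
  rw [trace_gam_mul σ (1 / 2), gam_gam hσ, Matrix.trace_mul_comm]
  norm_num

theorem trace_gam_one (hσ : σ.PosDef) (f : Mat d) :
    (gam σ 1 f).trace = (gam σ (1 / 2) f * rpow σ (1 / 2)).trace := by
  rw [← gam_one_right hσ (1 / 2), trace_gam_mul σ (1 / 2), gam_gam hσ, ← Matrix.mul_one (gam σ 1 f),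
    trace_gam_mul]
  norm_num

theorem absPow_two {X : Mat d} (hX : X.IsHermitian) : absPow X 2 = X * X := by
  conv_rhs => rw [← cfc_id_eq hX, cfc_mul_cfc]
  rw [absPow]
  congr 1
  ext x
  rw [show (2 : ℝ) = (2 : ℕ) by norm_num, Real.rpow_natCast, sq_abs, sq]

theorem trace_mul_self_nonneg {X : Mat d} (hX : X.IsHermitian) : 0 ≤ (X * X).trace.re := by
  have h := (Matrix.posSemidef_conjTranspose_mul_self X).trace_nonneg
  rw [hX.eq] at h
  exact (Complex.le_def.1 h).1

theorem wNorm_two_sq (hf : f.IsHermitian) :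
    wNorm σ 2 f ^ 2 = (gam σ (1 / 2) f * gam σ (1 / 2) f).trace.re := by
  rw [wNorm, absPow_two (isHermitian_gam hf _), ← Real.sqrt_eq_rpow,
    Real.sq_sqrt (trace_mul_self_nonneg (isHermitian_gam hf _))]

/-- In the eigenbases of $X=\Gamma_\sigma^{1/2}(f)$ and $\sigma$, the entropy is a weighted sum of
the scalar expressions of `sq_mul_log_div_bounds` at $x_i$ and $z=ry_j$, where $r=\|f\|_{2,\sigma}$
and $y_j^2$ are the eigenvalues of $\sigma$. The same sum of $(x_i-ry_j)^2$ is comparable to the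
variance. -/
theorem ent₂_bounds (hσ : σ.PosDef) (hσ1 : σ.trace = 1) (hf : f.PosDef) :
    1 / 2 * wVar σ f ≤ ent₂ σ f ∧
      ent₂ σ f ≤ (2 + Real.log (1 / minEigenvalue σ)) * wVar σ f := by
  have := nonempty_of_trace_eq_one hσ1
  have hX := posDef_gam hσ hf (1 / 2)
  rw [ent₂, wVar, wNorm_two_sq hf.1, trace_gam_one_mul_self hσ, trace_gam_one hσ]
  set X := gam σ (1 / 2) f
  obtain ⟨w, hw, hW⟩ := exists_weights hX.1 hσ.1
  set x := hX.1.eigenvalues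
  set l := hσ.1.eigenvalues
  have hx : ∀ i, 0 < x i := hX.eigenvalues_pos
  have hl : ∀ i, 0 < l i := hσ.eigenvalues_pos
  set y : Fin d → ℝ := fun j => l j ^ (1 / 2 : ℝ)
  have hy : ∀ j, 0 < y j := fun j => Real.rpow_pos_of_pos (hl j) _
  have hyl : ∀ j, y j ^ 2 = l j := fun j => by
    simp only [y]
    rw [← Real.sqrt_eq_rpow, Real.sq_sqrt (hl j).le]
  have hlogy : ∀ j, Real.log (l j) = 2 * Real.log (y j) := fun j => by
    rw [← hyl, Real.log_pow]; norm_num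
  have hXX : X * X = cfc (fun x : ℝ => x * x) X := by
    conv_lhs => rw [← cfc_id_eq hX.1, cfc_mul_cfc]
  have hN : (X * X).trace.re = ∑ i, ∑ j, x i ^ 2 * w i j := by
    have := hW (fun x => x * x) (fun _ => 1)
    rw [cfc_one_eq hσ.1, Matrix.mul_one, ← hXX] at this
    rw [this]
    simp [sq]
  have hN2 : (X * X).trace.re = ∑ i, x i ^ 2 := by
    rw [hXX, trace_cfc_re hX.1]
    simp [sq, x]
  have hs : (X * rpow σ (1 / 2)).trace.re = ∑ i, ∑ j, x i * y j * w i j := by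
    rw [← hW (fun x => x) (fun x => x ^ (1 / 2 : ℝ)), cfc_id_eq hX.1]
    rfl
  have h1 : (1 : ℝ) = ∑ i, ∑ j, y j ^ 2 * w i j := by
    have := hW (fun _ => 1) (fun x => x)
    rw [cfc_one_eq hX.1, Matrix.one_mul, cfc_id_eq hσ.1, hσ1] at this
    simp only [hyl]
    simpa using this
  have hA : (X * X * logm X).trace.re = ∑ i, ∑ j, x i ^ 2 * Real.log (x i) * w i j := by
    have := hW (fun x => x * x * Real.log x) (fun _ => 1)
    rw [cfc_one_eq hσ.1, Matrix.mul_one, ← cfc_mul_cfc, ← hXX] at this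
    rw [logm, this]
    simp [sq]
  have hB : (X * X * logm σ).trace.re = ∑ i, ∑ j, x i ^ 2 * (2 * Real.log (y j)) * w i j := by
    have := hW (fun x => x * x) Real.log
    rw [← hXX] at this
    rw [logm, this]
    simp only [← hlogy, sq]
  set N := (X * X).trace.re
  set s := (X * rpow σ (1 / 2)).trace.re
  have hN0 : 0 < N := by
    rw [hN2]
    exact Finset.sum_pos (fun i _ => pow_pos (hx i) 2) Finset.univ_nonempty
  set r := Real.sqrt N
  have hr : 0 < r := Real.sqrt_pos.2 hN0
  have hrN : r ^ 2 = N := Real.sq_sqrt hN0.le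
  have hlogN : Real.log N = 2 * Real.log r := by rw [← hrN, Real.log_pow]; norm_num
  -- Bounds $\log(x_i/(ry_j))$, since $x_i\le r$ and $y_j\ge\sigma_{\min}^{1/2}$.
  set m := 1 / 2 * Real.log (1 / minEigenvalue σ)
  have hmin := minEigenvalue_pos hσ
  have hm : 0 ≤ m := by
    have hd : (1 : ℝ) ≤ d := by
      exact_mod_cast Fin.pos_iff_nonempty.2 this
    have := dim_mul_minEigenvalue_le hσ.1 hσ1
    have h2 : minEigenvalue σ ≤ 1 := by nlinarith
    have : 0 ≤ Real.log (1 / minEigenvalue σ) := Real.log_nonneg (by rw [le_div_iff₀ hmin]; linarith)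
    simp only [m]; linarith
  have hpt : ∀ i j, Real.log (x i) - Real.log (r * y j) ≤ m := by
    intro i j
    have h1 : x i ≤ r := Real.le_sqrt_of_sq_le (by
      rw [hN2]
      exact Finset.single_le_sum (f := fun i => x i ^ 2) (fun i _ => sq_nonneg _)
        (Finset.mem_univ i))
    have h2 := Real.log_le_log (hx i) h1
    have h3 := Real.log_le_log hmin (minEigenvalue_le hσ.1 j)
    rw [hlogy] at h3
    rw [Real.log_mul hr.ne' (hy j).ne']
    simp only [m, one_div, Real.log_inv]
    linarith
  -- The added terms $-\frac12(x_i^2-r^2y_j^2)$ cancel in the sum: $x_i^2$ and $r^2y_j^2$ both have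
  -- weighted sum $N$.
  have hE : (X * X * logm X).trace.re - 1 / 2 * (X * X * logm σ).trace.re
      - 1 / 2 * N * Real.log N =
      ∑ i, ∑ j, (x i ^ 2 * (Real.log (x i) - Real.log (r * y j))
        - 1 / 2 * (x i ^ 2 - (r * y j) ^ 2)) * w i j := by
    have e : ∀ i j, (x i ^ 2 * (Real.log (x i) - Real.log (r * y j))
        - 1 / 2 * (x i ^ 2 - (r * y j) ^ 2)) * w i j =
        x i ^ 2 * Real.log (x i) * w i j - 1 / 2 * (x i ^ 2 * (2 * Real.log (y j)) * w i j)
        - Real.log r * (x i ^ 2 * w i j) - 1 / 2 * (x i ^ 2 * w i j)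
        + 1 / 2 * N * (y j ^ 2 * w i j) := by
      intro i j
      rw [Real.log_mul hr.ne' (hy j).ne', mul_pow, hrN]
      ring
    simp only [e, Finset.sum_add_distrib, Finset.sum_sub_distrib, ← Finset.mul_sum]
    simp only [← Finset.mul_sum] at hA hN
    rw [← hA, ← hB, ← hN, ← h1, hlogN]
    ring
  have hD : ∑ i, ∑ j, (x i - r * y j) ^ 2 * w i j = 2 * N - 2 * r * s := by
    have e : ∀ i j, (x i - r * y j) ^ 2 * w i j =
        x i ^ 2 * w i j - 2 * r * (x i * y j * w i j) + N * (y j ^ 2 * w i j) := by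
      intro i j
      rw [← hrN]
      ring
    simp only [e, Finset.sum_add_distrib, Finset.sum_sub_distrib, ← Finset.mul_sum]
    simp only [← Finset.mul_sum] at hN
    rw [← hN, ← hs, ← h1]
    ring
  have hD0 : 0 ≤ 2 * N - 2 * r * s := by
    rw [← hD]
    exact Finset.sum_nonneg fun i _ => Finset.sum_nonneg fun j _ =>
      mul_nonneg (sq_nonneg _) (hw i j)
  have hs0 : 0 ≤ s := by
    rw [hs]
    exact Finset.sum_nonneg fun i _ => Finset.sum_nonneg fun j _ =>
      mul_nonneg (mul_pos (hx i) (hy j)).le (hw i j)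
  have hb := fun i j => sq_mul_log_div_bounds (hx i) (mul_pos hr (hy j)) hm (hpt i j)
  rw [hE]
  -- The squares sum to $2r(r-s)$ and the variance is $(r-s)(r+s)$. As $0\le s\le r$, the variance
  -- lies between $r(r-s)$ and $2r(r-s)$.
  constructor
  · have : ∑ i, ∑ j, (1 / 2 * (x i - r * y j) ^ 2) * w i j ≤
        ∑ i, ∑ j, (x i ^ 2 * (Real.log (x i) - Real.log (r * y j))
        - 1 / 2 * (x i ^ 2 - (r * y j) ^ 2)) * w i j :=
      Finset.sum_le_sum fun i _ => Finset.sum_le_sum fun j _ =>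
        mul_le_mul_of_nonneg_right (hb i j).1 (hw i j)
    simp only [mul_assoc, ← Finset.mul_sum] at this
    simp only [mul_assoc] at hD ⊢
    rw [hD] at this
    nlinarith [sq_nonneg (r - s)]
  · have : ∑ i, ∑ j, (x i ^ 2 * (Real.log (x i) - Real.log (r * y j))
        - 1 / 2 * (x i ^ 2 - (r * y j) ^ 2)) * w i j ≤
        ∑ i, ∑ j, ((1 + m) * (x i - r * y j) ^ 2) * w i j :=
      Finset.sum_le_sum fun i _ => Finset.sum_le_sum fun j _ =>
        mul_le_mul_of_nonneg_right (hb i j).2 (hw i j)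
    simp only [mul_assoc, ← Finset.mul_sum] at this
    simp only [mul_assoc] at hD ⊢
    rw [hD] at this
    refine this.trans ?_
    have hsr : s ≤ r := by nlinarith
    have e : 2 + Real.log (1 / minEigenvalue σ) = 2 * (1 + m) := by simp only [m]; ring
    rw [e]
    have : N - r * s ≤ N - s ^ 2 := by nlinarith
    nlinarith

theorem wVar_eq (hσ : σ.PosDef) (hσ1 : σ.trace = 1) (g : Mat d) (m : ℝ)
    (hm : m = (gam σ 1 g).trace.re) :
    wVar σ g = (gam σ (1 / 2) (g - (m : ℂ) • 1) * gam σ (1 / 2) (g - (m : ℂ) • 1)).trace.re := by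
  rw [← trace_gam_one_mul_self hσ, wVar, gam_sub, gam_smul, gam_one_right hσ, rpow_one hσ]
  have h : (σ * g).trace = (gam σ 1 g).trace := by
    conv_lhs => rw [← rpow_one hσ, ← gam_one_right hσ, trace_gam_mul, Matrix.one_mul]
  simp only [Matrix.sub_mul, Matrix.mul_sub, Matrix.smul_mul, Matrix.mul_smul, Matrix.mul_one,
    Matrix.trace_sub, Matrix.trace_smul, h, hσ1, Complex.sub_re, smul_eq_mul, Complex.re_ofReal_mul,
    Complex.one_re, ← hm]
  ring

theorem wVar_nonneg (hσ : σ.PosDef) (hσ1 : σ.trace = 1) (hg : g.IsHermitian) :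
    0 ≤ wVar σ g := by
  rw [wVar_eq hσ hσ1 g _ rfl]
  refine trace_mul_self_nonneg (isHermitian_gam ?_ _)
  refine hg.sub ?_
  rw [Complex.coe_smul]
  exact Matrix.isHermitian_one.smul (IsSelfAdjoint.all _)

theorem exists_posDef_one_add (hg : g.IsHermitian) :
    ∃ ε : ℝ, 0 < ε ∧ (1 + (ε : ℂ) • g).PosDef := by
  set M := 1 + ∑ i, |hg.eigenvalues i| with hM
  have hM0 : 0 < M := by positivity
  refine ⟨M⁻¹, inv_pos.2 hM0, ?_⟩
  have h : 1 + ((M⁻¹ : ℝ) : ℂ) • g = cfc (fun x : ℝ => 1 + M⁻¹ * x) g := by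
    rw [Complex.coe_smul]
    rw [cfc_add g (fun _ => (1 : ℝ)) (fun x => M⁻¹ * x) (continuousOn_spectrum _ _)
      (continuousOn_spectrum _ _), cfc_one_eq hg]
    rw [show (fun x : ℝ => M⁻¹ * x) = fun x : ℝ => M⁻¹ • x from rfl,
      cfc_smul _ (fun x => x) g (continuousOn_spectrum _ _), cfc_id_eq hg]
  rw [h]
  refine posDef_cfc hg fun i => ?_
  have h1 : |hg.eigenvalues i| ≤ M - 1 := by
    rw [hM, add_sub_cancel_left]
    exact Finset.single_le_sum (f := fun i => |hg.eigenvalues i|) (fun i _ => abs_nonneg _)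
      (Finset.mem_univ i)
  have h2 : 0 < M + hg.eigenvalues i := by linarith [neg_abs_le (hg.eigenvalues i)]
  have : 1 + M⁻¹ * hg.eigenvalues i = M⁻¹ * (M + hg.eigenvalues i) := by field_simp
  rw [this]
  positivity

theorem wVar_one_add (hσ : σ.PosDef) (hσ1 : σ.trace = 1) (g : Mat d) (ε : ℝ) :
    wVar σ (1 + (ε : ℂ) • g) = ε ^ 2 * wVar σ g := by
  have h : (σ * g).trace = (gam σ 1 g).trace := by
    conv_lhs => rw [← rpow_one hσ, ← gam_one_right hσ, trace_gam_mul, Matrix.one_mul]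
  rw [wVar, gam_add, gam_smul, gam_one_right hσ, rpow_one hσ, wVar]
  simp only [Matrix.add_mul, Matrix.mul_add, Matrix.smul_mul, Matrix.mul_smul, Matrix.mul_one,
    Matrix.trace_add, Matrix.trace_smul, h, hσ1, Complex.add_re, smul_eq_mul, Complex.re_ofReal_mul,
    Complex.one_re]
  ring

theorem lindblad_one {k : ℕ} (H : Mat d) (L : Fin k → Mat d) : lindblad H L 1 = 0 := by
  simp only [lindblad, Matrix.mul_one, Matrix.one_mul, sub_self, smul_zero, zero_add]
  refine Finset.sum_eq_zero fun i _ => ?_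
  rw [← two_smul ℂ, smul_smul]
  norm_num

variable {𝓛 : SuperOp d}

theorem IsLiouvillian.map_one (hL : IsLiouvillian 𝓛) : 𝓛 1 = 0 := by
  obtain ⟨H, k, L, -, h⟩ := hL
  rw [h, lindblad_one]

theorem trace_stationary_mul (hσ : σ.IsHermitian) (h : hsDual 𝓛 σ = 0) (f : Mat d) :
    (σ * 𝓛 f).trace = 0 := by
  have h1 := trace_hsDual 𝓛 f σ
  rw [h, Matrix.mul_zero, Matrix.trace_zero] at h1
  have h2 := congrArg star h1
  rw [← Matrix.trace_conjTranspose, Matrix.conjTranspose_mul, conjTranspose_conjTranspose, hσ.eq,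
    star_zero] at h2
  exact h2.symm

theorem dirichlet₂_one_add (hσ : σ.PosDef) (hL : IsLiouvillian 𝓛) (h : hsDual 𝓛 σ = 0)
    (g : Mat d) (ε : ℝ) :
    dirichlet₂ 𝓛 σ (1 + (ε : ℂ) • g) = ε ^ 2 * dirichlet₂ 𝓛 σ g := by
  rw [dirichlet₂, dirichlet₂, wInner, wInner, map_add, hL.map_one, map_smul, gam_add, gam_smul,
    gam_one_right hσ, rpow_one hσ]
  simp only [Matrix.add_mul, Matrix.smul_mul, Matrix.mul_smul, zero_add,
    Matrix.trace_add, Matrix.trace_smul, trace_stationary_mul hσ.1 h, smul_eq_mul,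
    Complex.re_ofReal_mul]
  ring

/-- The $LS_2$ inequality only concerns positive definite matrices, but variance and Dirichlet form
ignore the identity and are quadratic, so it suffices to test on $1+\varepsilon g$. This supplies
positivity of the gap and $\mathcal E_2\ge0$ where the variance vanishes. -/
theorem dirichlet₂_ge_of_logSobolev (hσ : σ.PosDef) (hσ1 : σ.trace = 1) (hL : IsLiouvillian 𝓛)
    (h : hsDual 𝓛 σ = 0) {α : ℝ} (hα : 0 < α)
    (hLS : ∀ f : Mat d, f.PosDef → α * ent₂ σ f ≤ dirichlet₂ 𝓛 σ f) (hg : g.IsHermitian) :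
    α / 2 * wVar σ g ≤ dirichlet₂ 𝓛 σ g := by
  obtain ⟨ε, hε, hp⟩ := exists_posDef_one_add hg
  have h1 := hLS _ hp
  have h2 := mul_le_mul_of_nonneg_left (ent₂_bounds hσ hσ1 hp).1 hα.le
  rw [wVar_one_add hσ hσ1] at h2
  rw [dirichlet₂_one_add hσ hL h] at h1
  have h3 : ε ^ 2 * (α / 2 * wVar σ g) ≤ ε ^ 2 * dirichlet₂ 𝓛 σ g := by linarith
  exact le_of_mul_le_mul_left h3 (by positivity)

theorem spectralGap_pos (hσ : σ.PosDef) (hσ1 : σ.trace = 1) (hL : IsLiouvillian 𝓛)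
    (h : hsDual 𝓛 σ = 0) {α gap : ℝ} (hα : IsLogSobolevConst₂ 𝓛 σ α)
    (hgap : IsSpectralGap 𝓛 σ gap) : 0 < gap := by
  obtain ⟨g, hg, hv, rfl⟩ := hgap.1
  have hv' : 0 < wVar σ g := lt_of_le_of_ne (wVar_nonneg hσ hσ1 hg) hv.symm
  have := dirichlet₂_ge_of_logSobolev hσ hσ1 hL h hα.1.1 hα.1.2 hg
  exact div_pos (lt_of_lt_of_le (mul_pos (half_pos hα.1.1) hv') this) hv'

theorem spectralGap_mul_wVar_le (hσ : σ.PosDef) (hσ1 : σ.trace = 1) (hL : IsLiouvillian 𝓛)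
    (h : hsDual 𝓛 σ = 0) {α gap : ℝ} (hα : IsLogSobolevConst₂ 𝓛 σ α)
    (hgap : IsSpectralGap 𝓛 σ gap) (hg : g.IsHermitian) :
    gap * wVar σ g ≤ dirichlet₂ 𝓛 σ g := by
  by_cases hv : wVar σ g = 0
  · have := dirichlet₂_ge_of_logSobolev hσ hσ1 hL h hα.1.1 hα.1.2 hg
    rw [hv, mul_zero] at this ⊢
    exact this
  · have hv' : 0 < wVar σ g := lt_of_le_of_ne (wVar_nonneg hσ hσ1 hg) (Ne.symm hv)
    exact (le_div_iff₀ hv').1 (hgap.2 ⟨g, hg, hv, rfl⟩)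

theorem spectralGap_le (hσ : σ.PosDef) (hσ1 : σ.trace = 1) (hL : IsLiouvillian 𝓛)
    (h : hsDual 𝓛 σ = 0) {α gap : ℝ} (hα : IsLogSobolevConst₂ 𝓛 σ α)
    (hgap : IsSpectralGap 𝓛 σ gap) (hmin : 0 ≤ Real.log (1 / minEigenvalue σ)) :
    gap ≤ (2 + Real.log (1 / minEigenvalue σ)) * α := by
  have hg0 := spectralGap_pos hσ hσ1 hL h hα hgap
  have hK : 0 < 2 + Real.log (1 / minEigenvalue σ) := by linarith
  rw [← div_le_iff₀' hK]
  -- Maximality of $\alpha$: the number $\lambda/(2+\log(1/\sigma_{\min}))$ is itself an admissible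
  -- log-Sobolev constant.
  refine hα.2 ⟨div_pos hg0 hK, fun f hf => ?_⟩
  have h1 := (ent₂_bounds hσ hσ1 hf).2
  have h2 := spectralGap_mul_wVar_le hσ hσ1 hL h hα hgap hf.1
  rw [div_mul_eq_mul_div, div_le_iff₀ hK]
  nlinarith

end Entropy

end QMS

namespace QMS

open Matrix Filter Topology
open scoped ComplexOrder Matrix.Norms.Operator

/-! ### The semigroup: differential equation, positivity and duality -/

section Semigroup

variable {d : ℕ} {𝓛 : SuperOp d}

theorem hasDerivAt_linear_comp {F G : Type*} [NormedAddCommGroup F] [NormedSpace ℝ F]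
    [FiniteDimensional ℝ F] [NormedAddCommGroup G] [NormedSpace ℝ G] (Λ : F →ₗ[ℝ] G)
    {u : ℝ → F} {u' : F} {t : ℝ} (h : HasDerivAt u u' t) :
    HasDerivAt (fun s => Λ (u s)) (Λ u') t :=
  (LinearMap.toContinuousLinearMap Λ).hasFDerivAt.comp_hasDerivAt t h

/-- The matrix of a linear map on matrices in the basis of matrix units. -/
noncomputable def genMatrix (𝓛 : SuperOp d) : Matrix (Fin d × Fin d) (Fin d × Fin d) ℂ :=
  LinearMap.toMatrix (Matrix.stdBasis ℂ (Fin d) (Fin d)) (Matrix.stdBasis ℂ (Fin d) (Fin d)) 𝓛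

/-- The linear map with a given matrix in the basis of matrix units. -/
noncomputable def ofGenMatrix (d : ℕ) :
    Matrix (Fin d × Fin d) (Fin d × Fin d) ℂ →ₗ[ℝ] SuperOp d :=
  (Matrix.toLin (Matrix.stdBasis ℂ (Fin d) (Fin d))
    (Matrix.stdBasis ℂ (Fin d) (Fin d))).toLinearMap.restrictScalars ℝ

theorem ofGenMatrix_mul (M N : Matrix (Fin d × Fin d) (Fin d × Fin d) ℂ) :
    ofGenMatrix d (M * N) = ofGenMatrix d M ∘ₗ ofGenMatrix d N :=
  Matrix.toLin_mul _ _ _ M N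

theorem ofGenMatrix_genMatrix (𝓛 : SuperOp d) : ofGenMatrix d (genMatrix 𝓛) = 𝓛 :=
  Matrix.toLin_toMatrix _ _ 𝓛

theorem semigroup_zero (𝓛 : SuperOp d) : semigroup 𝓛 0 = LinearMap.id := by
  rw [semigroup]
  simp [NormedSpace.exp_zero]

/-- The generator commutes with its exponential. The first order of composition drives $T_tf$, the
second drives $T_t^*\rho$. -/
theorem hasDerivAt_semigroup_linear {F : Type*} [NormedAddCommGroup F] [NormedSpace ℝ F]
    (𝓛 : SuperOp d) (Λ : SuperOp d →ₗ[ℝ] F) (t : ℝ) :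
    HasDerivAt (fun s => Λ (semigroup 𝓛 s)) (Λ (𝓛 ∘ₗ semigroup 𝓛 t)) t ∧
      HasDerivAt (fun s => Λ (semigroup 𝓛 s)) (Λ (semigroup 𝓛 t ∘ₗ 𝓛)) t := by
  have h1 := (hasDerivAt_exp_smul_const' (genMatrix 𝓛) t)
  have h2 := (hasDerivAt_exp_smul_const (genMatrix 𝓛) t)
  have e1 := hasDerivAt_linear_comp (Λ ∘ₗ ofGenMatrix d) h1
  have e2 := hasDerivAt_linear_comp (Λ ∘ₗ ofGenMatrix d) h2
  simp only [LinearMap.comp_apply, ofGenMatrix_mul, ofGenMatrix_genMatrix] at e1 e2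
  exact ⟨e1, e2⟩

/-- Evaluation of linear maps at a matrix. -/
def evalAt (f : Mat d) : SuperOp d →ₗ[ℝ] Mat d where
  toFun Φ := Φ f
  map_add' _ _ := rfl
  map_smul' _ _ := rfl

theorem hasDerivAt_semigroup (𝓛 : SuperOp d) (f : Mat d) (t : ℝ) :
    HasDerivAt (fun s => semigroup 𝓛 s f) (𝓛 (semigroup 𝓛 t f)) t :=
  (hasDerivAt_semigroup_linear 𝓛 (evalAt f) t).1

/-- Uniqueness for the linear equation transfers identities from the generator to the semigroup:
fixing $1$, commuting with the adjoint, fixing $\sigma$. -/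
theorem eq_zero_of_hasDerivAt (𝓛 : SuperOp d) {u : ℝ → Mat d}
    (hu : ∀ t, HasDerivAt u (𝓛 (u t)) t) (h0 : u 0 = 0) (t : ℝ) : u t = 0 := by
  have hl := (LinearMap.toContinuousLinearMap 𝓛).lipschitz
  have := ODE_solution_unique_univ (v := fun _ => 𝓛) (s := fun _ => Set.univ) (f := u)
    (g := fun _ => 0) (t₀ := 0) (fun _ => hl.lipschitzOnWith (s := Set.univ))
    (fun t => ⟨hu t, trivial⟩)
    (fun t => ⟨by rw [map_zero]; exact hasDerivAt_const t 0, trivial⟩) h0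
  rw [this]

theorem semigroup_apply_eq_self {f : Mat d} (h : 𝓛 f = 0) (t : ℝ) : semigroup 𝓛 t f = f := by
  refine sub_eq_zero.1 (eq_zero_of_hasDerivAt 𝓛 (u := fun t => semigroup 𝓛 t f - f)
    (fun t => ?_) (by simp [semigroup_zero]) t)
  rw [map_sub, h, sub_zero]
  exact (hasDerivAt_semigroup 𝓛 f t).sub_const f

/-- The conjugate transpose as a real-linear map. -/
def conjTransposeLin (d : ℕ) : Mat d →ₗ[ℝ] Mat d where
  toFun f := fᴴ
  map_add' f g := Matrix.conjTranspose_add f g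
  map_smul' a f := by simp [Matrix.conjTranspose_smul]

theorem IsLiouvillian.map_conjTranspose (hL : IsLiouvillian 𝓛) (f : Mat d) : 𝓛 fᴴ = (𝓛 f)ᴴ := by
  obtain ⟨H, k, L, hH, h⟩ := hL
  rw [h, h, lindblad, lindblad]
  simp only [Matrix.conjTranspose_add, Matrix.conjTranspose_smul, Matrix.conjTranspose_sub,
    Matrix.conjTranspose_sum, Matrix.conjTranspose_mul, conjTranspose_conjTranspose, hH.eq]
  congr 1
  · simp [smul_sub, neg_add_eq_sub]
  · refine Finset.sum_congr rfl fun i _ => ?_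
    simp only [Matrix.mul_assoc, one_div, star_inv₀, star_ofNat]
    rw [add_comm]

theorem semigroup_conjTranspose (hL : IsLiouvillian 𝓛) (f : Mat d) (t : ℝ) :
    semigroup 𝓛 t fᴴ = (semigroup 𝓛 t f)ᴴ := by
  refine sub_eq_zero.1 (eq_zero_of_hasDerivAt 𝓛
    (u := fun t => semigroup 𝓛 t fᴴ - (semigroup 𝓛 t f)ᴴ)
    (fun t => ?_) (by simp [semigroup_zero]) t)
  rw [map_sub, hL.map_conjTranspose]
  exact (hasDerivAt_semigroup 𝓛 fᴴ t).sub
    (hasDerivAt_linear_comp (conjTransposeLin d) (hasDerivAt_semigroup 𝓛 f t))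

theorem isHermitian_semigroup (hL : IsLiouvillian 𝓛) {f : Mat d} (hf : f.IsHermitian) (t : ℝ) :
    (semigroup 𝓛 t f).IsHermitian := by
  rw [Matrix.IsHermitian, ← semigroup_conjTranspose hL, hf.eq]

/-- On the kernel of $g$ every term with $g$ at an outer end vanishes. Only $\langle
L_iv,gL_iv\rangle\ge0$ survives. -/
theorem lindblad_quadratic_nonneg {k : ℕ} (H : Mat d) (L : Fin k → Mat d) {g : Mat d}
    (hg : g.PosSemidef) {v : Fin d → ℂ} (hv : g *ᵥ v = 0) :
    0 ≤ (star v ⬝ᵥ (lindblad H L g *ᵥ v)).re := by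
  have hv' : star v ᵥ* g = 0 := by
    have := congrArg star hv
    rwa [Matrix.star_mulVec, hg.1.eq, star_zero] at this
  have r : ∀ A : Mat d, star v ⬝ᵥ ((A * g) *ᵥ v) = 0 := fun A => by
    rw [← Matrix.mulVec_mulVec, hv, Matrix.mulVec_zero, dotProduct_zero]
  have l : ∀ A : Mat d, star v ⬝ᵥ ((g * A) *ᵥ v) = 0 := fun A => by
    rw [← Matrix.mulVec_mulVec, Matrix.dotProduct_mulVec, hv', zero_dotProduct]
  simp only [lindblad, Matrix.add_mulVec, Matrix.smul_mulVec, Matrix.sub_mulVec, dotProduct_add,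
    dotProduct_smul, dotProduct_sub, r, l, Matrix.sum_mulVec, dotProduct_sum, sub_zero, smul_zero,
    add_zero, zero_add, Complex.re_sum]
  exact Finset.sum_nonneg fun i _ => (hg.conjTranspose_mul_mul_same (L i)).re_dotProduct_nonneg v

theorem posSemidef_of_re {A : Mat d} (hA : A.IsHermitian)
    (h : ∀ v : Fin d → ℂ, 0 ≤ (star v ⬝ᵥ (A *ᵥ v)).re) : A.PosSemidef :=
  .of_dotProduct_mulVec_nonneg hA fun v =>
    Complex.le_def.2 ⟨h v, (hA.im_star_dotProduct_mulVec_self v).symm⟩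

/-- The quadratic form of a matrix at a fixed vector, as a real-linear functional of the matrix. -/
def quadAt (v : Fin d → ℂ) : Mat d →ₗ[ℝ] ℝ where
  toFun A := (star v ⬝ᵥ (A *ᵥ v)).re
  map_add' A B := by simp [Matrix.add_mulVec]
  map_smul' a A := by simp [Matrix.smul_mulVec]

theorem re_star_dotProduct_self_pos {v : Fin d → ℂ} (hv : v ≠ 0) : 0 < (star v ⬝ᵥ v).re :=
  (Complex.lt_def.1 (Matrix.dotProduct_star_self_pos_iff.2 hv)).1

theorem quadAt_pos_of_sphere {A : Mat d}
    (h : ∀ v : Fin d → ℂ, ‖v‖ = 1 → 0 ≤ quadAt v A) (v : Fin d → ℂ) : 0 ≤ quadAt v A := by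
  rcases eq_or_ne v 0 with rfl | hv
  · simp [quadAt]
  · have hn : 0 < ‖v‖ := norm_pos_iff.2 hv
    have h1 := h ((‖v‖⁻¹ : ℝ) • v) (by rw [norm_smul]; simp [hn.ne'])
    have e : quadAt ((‖v‖⁻¹ : ℝ) • v) A = ‖v‖⁻¹ * (‖v‖⁻¹ * quadAt v A) := by
      simp only [quadAt, LinearMap.coe_mk, AddHom.coe_mk, star_smul, star_trivial,
        Matrix.mulVec_smul, smul_dotProduct, dotProduct_smul, Complex.real_smul,
        Complex.re_ofReal_mul]
    rw [e] at h1
    have hi : 0 < ‖v‖⁻¹ := inv_pos.2 hn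
    exact (mul_nonneg_iff_of_pos_left hi).1 ((mul_nonneg_iff_of_pos_left hi).1 h1)

/-- Barrier argument: at the first time the perturbed flow has a null vector, the quadratic form
there has derivative at least $\varepsilon\|v\|_2^2>0$, although it was positive before and is zero
now. The shift $\varepsilon(1+t)$ makes both the initial value and the derivative strict. -/
theorem semigroup_add_pos (hL : IsLiouvillian 𝓛) {f : Mat d} (hf : f.PosSemidef) {ε : ℝ}
    (hε : 0 < ε) {T : ℝ} (hT : 0 ≤ T) {v : Fin d → ℂ} (hv : ‖v‖ = 1) :
    0 < quadAt v (semigroup 𝓛 T f + (ε * (1 + T)) • (1 : Mat d)) := by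
  set g : ℝ → Mat d := fun t => semigroup 𝓛 t f + (ε * (1 + t)) • (1 : Mat d) with hgdef
  have hgd : ∀ t, HasDerivAt g (𝓛 (g t) + ε • (1 : Mat d)) t := by
    intro t
    have h1 : 𝓛 (g t) = 𝓛 (semigroup 𝓛 t f) := by
      simp only [hgdef, map_add]
      rw [show 𝓛 ((ε * (1 + t)) • (1 : Mat d)) = (ε * (1 + t)) • 𝓛 1 from
        LinearMap.map_smul_of_tower 𝓛 _ _, hL.map_one, smul_zero, add_zero]
    rw [h1]
    refine (hasDerivAt_semigroup 𝓛 f t).add ?_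
    have h2 : HasDerivAt (fun t : ℝ => ε * (1 + t)) ε t := by
      simpa using ((hasDerivAt_id t).const_add 1).const_mul ε
    exact h2.smul_const (1 : Mat d)
  have hgc : Continuous g := continuous_iff_continuousAt.2 fun t => (hgd t).continuousAt
  have hgH : ∀ t, (g t).IsHermitian := fun t =>
    (isHermitian_semigroup hL hf.1 t).add (Matrix.isHermitian_one.smul (IsSelfAdjoint.all _))
  have hone : ∀ w : Fin d → ℂ, ‖w‖ = 1 → 0 < quadAt w (1 : Mat d) := fun w hw => by
    simp only [quadAt, LinearMap.coe_mk, AddHom.coe_mk, Matrix.one_mulVec]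
    exact re_star_dotProduct_self_pos (norm_ne_zero_iff.1 (by rw [hw]; exact one_ne_zero))
  have hqc : Continuous fun p : ℝ × (Fin d → ℂ) => quadAt p.2 (g p.1) := by
    simp only [quadAt, LinearMap.coe_mk, AddHom.coe_mk]
    exact Complex.continuous_re.comp ((continuous_star.comp continuous_snd).dotProduct
      ((hgc.comp continuous_fst).matrix_mulVec continuous_snd))
  by_contra hcon
  rw [not_lt] at hcon
  -- The set of times and unit vectors where positivity fails is compact, so a failure would have an
  -- earliest time.
  set S : Set (ℝ × (Fin d → ℂ)) :=
    (Set.Icc 0 T ×ˢ Metric.sphere 0 1) ∩ {p | quadAt p.2 (g p.1) ≤ 0}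
  have hS : IsCompact S :=
    (isCompact_Icc.prod (isCompact_sphere 0 1)).inter_right (isClosed_le hqc continuous_const)
  obtain ⟨⟨t, w⟩, ⟨⟨ht, hw⟩, hq⟩, hmin⟩ := hS.exists_isMinOn
    ⟨(T, v), ⟨⟨⟨hT, le_rfl⟩, by simpa using hv⟩, hcon⟩⟩ continuous_fst.continuousOn
  simp only [Set.mem_ofPred_eq, mem_sphere_zero_iff_norm] at ht hw hq
  have hbefore : ∀ s, 0 ≤ s → s < t → ∀ z : Fin d → ℂ, ‖z‖ = 1 → 0 < quadAt z (g s) := by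
    intro s hs0 hst z hz
    by_contra hc
    rw [not_lt] at hc
    have := hmin (show (s, z) ∈ S from ⟨⟨⟨hs0, hst.le.trans ht.2⟩, by simpa using hz⟩, hc⟩)
    simp only [Set.mem_ofPred_eq] at this
    linarith
  have ht0 : 0 < t := by
    rcases ht.1.lt_or_eq with h | h
    · exact h
    · exfalso
      rw [← h] at hq
      have : g 0 = f + ε • (1 : Mat d) := by simp [hgdef, semigroup_zero]
      rw [this, map_add, map_smul, smul_eq_mul] at hq
      have h1 : 0 ≤ quadAt w f := hf.re_dotProduct_nonneg w
      have h2 := mul_pos hε (hone w hw)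
      linarith
  have hps : (g t).PosSemidef := by
    refine posSemidef_of_re (hgH t) (quadAt_pos_of_sphere fun z hz => ?_)
    have hc : Continuous fun s => quadAt z (g s) :=
      hqc.comp (continuous_id.prodMk continuous_const)
    refine ge_of_tendsto (x := 𝓝[<] t) (hc.continuousAt.tendsto.mono_left nhdsWithin_le_nhds) ?_
    filter_upwards [Ioo_mem_nhdsLT ht0] with s hs
    exact (hbefore s hs.1.le hs.2 z hz).le
  have hq0 : quadAt w (g t) = 0 := le_antisymm hq (hps.re_dotProduct_nonneg w)
  have hker : g t *ᵥ w = 0 := by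
    rw [← hps.dotProduct_mulVec_zero_iff]
    exact Complex.ext hq0 ((hgH t).im_star_dotProduct_mulVec_self w)
  have hder := hasDerivAt_linear_comp (quadAt w) (hgd t)
  have hpos : 0 < quadAt w (𝓛 (g t) + ε • (1 : Mat d)) := by
    rw [map_add, map_smul, smul_eq_mul]
    refine add_pos_of_nonneg_of_pos ?_ (mul_pos hε (hone w hw))
    obtain ⟨H, k, L, -, h⟩ := hL
    rw [h]
    exact lindblad_quadratic_nonneg H L hps hker
  have hslope := (hasDerivAt_iff_tendsto_slope_left_right.1 hder).1
  obtain ⟨s, hs, hs0, hst⟩ :=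
    ((hslope.eventually (lt_mem_nhds hpos)).and (Ioo_mem_nhdsLT ht0)).exists
  rw [slope_def_field, hq0, sub_zero] at hs
  have h3 := hbefore s hs0.le hst w hw
  exact absurd hs (not_lt.2 (div_nonpos_of_nonneg_of_nonpos h3.le (by linarith)))

theorem posSemidef_semigroup (hL : IsLiouvillian 𝓛) {f : Mat d} (hf : f.PosSemidef) {t : ℝ}
    (ht : 0 ≤ t) : (semigroup 𝓛 t f).PosSemidef := by
  refine posSemidef_of_re (isHermitian_semigroup hL hf.1 t) (quadAt_pos_of_sphere fun v hv => ?_)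
  have h : ∀ ε > 0, 0 ≤ quadAt v (semigroup 𝓛 t f) + ε := by
    intro ε hε
    have hw : 0 ≤ quadAt v (1 : Mat d) := Matrix.PosSemidef.one.re_dotProduct_nonneg v
    set c := (1 + t) * quadAt v (1 : Mat d) with hc
    have hc0 : 0 ≤ c := by positivity
    have := semigroup_add_pos hL hf (show 0 < ε / (1 + c) by positivity) ht hv
    rw [map_add, map_smul, smul_eq_mul, mul_assoc, ← hc] at this
    have h2 : ε / (1 + c) * c ≤ ε := by
      rw [div_mul_eq_mul_div, div_le_iff₀ (by positivity)]
      nlinarith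
    linarith
  exact le_of_forall_pos_le_add h

theorem posDef_semigroup (hL : IsLiouvillian 𝓛) {f : Mat d} (hf : f.PosDef) {t : ℝ}
    (ht : 0 ≤ t) : (semigroup 𝓛 t f).PosDef := by
  rcases isEmpty_or_nonempty (Fin d) with hd | hd
  · exact ⟨Subsingleton.elim _ _, fun x hx => absurd (Subsingleton.elim x 0) hx⟩
  set m := minEigenvalue f
  have hm : 0 < m := minEigenvalue_pos hf
  have h1 : (f - (m : ℂ) • 1).PosSemidef := by
    rw [← cfc_sub_const hf.1]
    exact posSemidef_cfc hf.1 fun i => sub_nonneg.2 (minEigenvalue_le hf.1 i)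
  have h2 := posSemidef_semigroup hL h1 ht
  rw [map_sub, map_smul, semigroup_apply_eq_self hL.map_one] at h2
  have h3 := Matrix.PosDef.posSemidef_add h2 (Matrix.PosDef.one.smul (a := (m : ℂ)) (by exact_mod_cast hm))
  rwa [sub_add_cancel] at h3

theorem trace_mul_re_nonneg {A B : Mat d} (hA : A.PosSemidef) (hB : B.PosSemidef) :
    0 ≤ (A * B).trace.re := by
  obtain ⟨w, hw, hW⟩ := exists_weights hA.1 hB.1
  have := hW (fun x => x) (fun x => x)
  rw [cfc_id_eq hA.1, cfc_id_eq hB.1] at this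
  rw [this]
  exact Finset.sum_nonneg fun i _ => Finset.sum_nonneg fun j _ =>
    mul_nonneg (mul_nonneg (hA.eigenvalues_nonneg i) (hB.eigenvalues_nonneg j)) (hw i j)

/-! ### The dual semigroup on states -/

theorem eq_of_trace_conjTranspose_mul {A B : Mat d}
    (h : ∀ f : Mat d, (fᴴ * A).trace = (fᴴ * B).trace) : A = B := by
  ext i j
  have := h (Matrix.single i j 1)
  simpa [Matrix.conjTranspose_single, Matrix.trace_single_mul] using this

/-- The action on a fixed matrix of the Hilbert–Schmidt dual, which is real-linear in the map. -/
noncomputable def hsDualAt (ρ : Mat d) : SuperOp d →ₗ[ℝ] Mat d where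
  toFun Φ := hsDual Φ ρ
  map_add' Φ Ψ := eq_of_trace_conjTranspose_mul fun f => by
    simp only [trace_hsDual, LinearMap.add_apply, Matrix.conjTranspose_add, Matrix.add_mul,
      Matrix.mul_add, Matrix.trace_add]
  map_smul' a Φ := eq_of_trace_conjTranspose_mul fun f => by
    simp only [trace_hsDual, LinearMap.smul_apply, Matrix.conjTranspose_smul, Matrix.smul_mul,
      Matrix.mul_smul, Matrix.trace_smul, star_trivial, RingHom.id_apply]

theorem hsDual_comp (Φ Ψ : SuperOp d) (ρ : Mat d) :
    hsDual (Φ ∘ₗ Ψ) ρ = hsDual Ψ (hsDual Φ ρ) :=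
  eq_of_trace_conjTranspose_mul fun f => by simp only [trace_hsDual, LinearMap.comp_apply]

theorem hasDerivAt_hsDual_semigroup (𝓛 : SuperOp d) (ρ : Mat d) (t : ℝ) :
    HasDerivAt (fun s => hsDual (semigroup 𝓛 s) ρ) (hsDual 𝓛 (hsDual (semigroup 𝓛 t) ρ)) t := by
  rw [← hsDual_comp]
  exact (hasDerivAt_semigroup_linear 𝓛 (hsDualAt ρ) t).2

theorem hsDual_semigroup_zero (𝓛 : SuperOp d) (ρ : Mat d) : hsDual (semigroup 𝓛 0) ρ = ρ :=
  eq_of_trace_conjTranspose_mul fun f => by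
    rw [trace_hsDual, semigroup_zero, LinearMap.id_apply]

theorem hsDual_semigroup_stationary {σ : Mat d} (h : hsDual 𝓛 σ = 0) (t : ℝ) :
    hsDual (semigroup 𝓛 t) σ = σ := by
  refine sub_eq_zero.1 (eq_zero_of_hasDerivAt (hsDual 𝓛)
    (u := fun t => hsDual (semigroup 𝓛 t) σ - σ)
    (fun t => ?_) (by simp [hsDual_semigroup_zero]) t)
  rw [map_sub, h, sub_zero]
  exact (hasDerivAt_hsDual_semigroup 𝓛 σ t).sub_const σ

theorem trace_hsDual_semigroup (hL : IsLiouvillian 𝓛) (ρ : Mat d) (t : ℝ) :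
    (hsDual (semigroup 𝓛 t) ρ).trace = ρ.trace := by
  have := trace_hsDual (semigroup 𝓛 t) 1 ρ
  rw [semigroup_apply_eq_self hL.map_one] at this
  simpa using this

theorem isHermitian_hsDual_semigroup (hL : IsLiouvillian 𝓛) {ρ : Mat d} (hρ : ρ.IsHermitian)
    (t : ℝ) : (hsDual (semigroup 𝓛 t) ρ).IsHermitian := by
  refine eq_of_trace_conjTranspose_mul fun f => ?_
  have h1 : ∀ A B : Mat d, (Aᴴ * Bᴴ).trace = star (A * B).trace := fun A B => by
    rw [← Matrix.trace_conjTranspose, Matrix.conjTranspose_mul, Matrix.trace_mul_comm]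
  have h2 := trace_hsDual (semigroup 𝓛 t) fᴴ ρ
  rw [conjTranspose_conjTranspose, semigroup_conjTranspose hL, conjTranspose_conjTranspose] at h2
  rw [h1, h2, trace_hsDual, ← h1, hρ.eq]

theorem posSemidef_hsDual_semigroup (hL : IsLiouvillian 𝓛) {ρ : Mat d} (hρ : ρ.PosSemidef)
    {t : ℝ} (ht : 0 ≤ t) : (hsDual (semigroup 𝓛 t) ρ).PosSemidef := by
  refine posSemidef_of_re (isHermitian_hsDual_semigroup hL hρ.1 t) fun v => ?_
  -- The quadratic form of $T_t^*\rho$ at $v$ is $\operatorname{tr}(T_t(vv^\dagger)\rho)$.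
  have hv := Matrix.posSemidef_vecMulVec_self_star v
  have h := trace_hsDual (semigroup 𝓛 t) (vecMulVec v (star v)) ρ
  rw [(posSemidef_semigroup hL hv ht).1.eq, hv.1.eq, Matrix.vecMulVec_mul, Matrix.trace_vecMulVec,
    dotProduct_comm, ← Matrix.dotProduct_mulVec] at h
  rw [h]
  exact trace_mul_re_nonneg (posSemidef_semigroup hL hv ht) hρ

theorem trace_hsDual_mul (hL : IsLiouvillian 𝓛) {f : Mat d} (hf : f.IsHermitian) (ρ : Mat d) :
    (f * hsDual 𝓛 ρ).trace = (𝓛 f * ρ).trace := by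
  have := trace_hsDual 𝓛 f ρ
  rwa [← hL.map_conjTranspose, hf.eq] at this

theorem trace_hsDual_semigroup_mul (hL : IsLiouvillian 𝓛) {f : Mat d} (hf : f.IsHermitian)
    (ρ : Mat d) (t : ℝ) :
    (f * hsDual (semigroup 𝓛 t) ρ).trace = (semigroup 𝓛 t f * ρ).trace := by
  have := trace_hsDual (semigroup 𝓛 t) f ρ
  rwa [← semigroup_conjTranspose hL, hf.eq] at this

end Semigroup

/-! ### Exponential decay of the divergence at the rate of the gap -/

section Decay

variable {d : ℕ} {𝓛 : SuperOp d} {σ ρ : Mat d}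

/-- The powers of the weighting map, as real-linear maps. -/
noncomputable def gamLin (σ : Mat d) (r : ℝ) : Mat d →ₗ[ℝ] Mat d where
  toFun := gam σ r
  map_add' := gam_add σ r
  map_smul' a f := by simp [gam]

/-- The real part of the trace, as a real-linear functional. -/
def reTrace (d : ℕ) : Mat d →ₗ[ℝ] ℝ where
  toFun A := A.trace.re
  map_add' A B := by simp
  map_smul' a A := by simp

theorem hasDerivAt_trace_mul {A B : ℝ → Mat d} {A' B' : Mat d} {t : ℝ} (hA : HasDerivAt A A' t)
    (hB : HasDerivAt B B' t) :
    HasDerivAt (fun s => (A s * B s).trace.re) ((A' * B t).trace.re + (A t * B').trace.re) t := by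
  have := hasDerivAt_linear_comp (reTrace d) (hA.mul hB)
  rw [map_add] at this
  exact this

theorem wVar_gam_neg_one (hσ : σ.PosDef) {φ : Mat d} (hφ : φ.trace = 0) :
    wVar σ (gam σ (-1) φ) = (φ * gam σ (-1) φ).trace.re := by
  rw [wVar, gam_gam_neg hσ, hφ]
  simp

theorem hasDerivAt_chiSq (hσ : σ.PosDef) (hL : IsLiouvillian 𝓛) (h : hsDual 𝓛 σ = 0)
    (hρ : ρ.IsHermitian) (t : ℝ) :
    HasDerivAt (fun s => chiSq (hsDual (semigroup 𝓛 s) ρ) σ)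
      (-2 * dirichlet₂ 𝓛 σ (gam σ (-1) (hsDual (semigroup 𝓛 t) ρ - σ))) t := by
  set φ := fun s => hsDual (semigroup 𝓛 s) ρ - σ with hφ
  have hd : ∀ s, HasDerivAt φ (hsDual 𝓛 (φ s)) s := fun s => by
    simp only [hφ, map_sub, h, sub_zero]
    exact (hasDerivAt_hsDual_semigroup 𝓛 ρ s).sub_const σ
  have hg : (gam σ (-1) (φ t)).IsHermitian :=
    isHermitian_gam ((isHermitian_hsDual_semigroup hL hρ t).sub hσ.1) _
  refine (hasDerivAt_trace_mul (hd t)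
    (hasDerivAt_linear_comp (gamLin σ (-1)) (hd t))).congr_deriv ?_
  change (hsDual 𝓛 (φ t) * gam σ (-1) (φ t)).trace.re
    + (φ t * gam σ (-1) (hsDual 𝓛 (φ t))).trace.re = -2 * dirichlet₂ 𝓛 σ (gam σ (-1) (φ t))
  rw [← trace_gam_mul σ (-1) (φ t), Matrix.trace_mul_comm (hsDual 𝓛 (φ t)), trace_hsDual_mul hL hg, dirichlet₂, wInner,
    gam_gam_neg hσ, Matrix.trace_mul_comm (φ t)]
  ring

/-- Grönwall's argument.

The derivative of $\chi^2$ is $-2\mathcal E_2(\Gamma_\sigma^{-1}(\rho_t-\sigma))$, where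
$\rho_t=T_t^*\rho$, and since $\rho_t-\sigma$ is traceless the variance of the same matrix is
$\chi^2$ itself. -/
theorem chiSq_decay (hσ : σ.PosDef) (hσ1 : σ.trace = 1) (hL : IsLiouvillian 𝓛)
    (h : hsDual 𝓛 σ = 0) {α gap : ℝ} (hα : IsLogSobolevConst₂ 𝓛 σ α)
    (hgap : IsSpectralGap 𝓛 σ gap) (hρ : ρ.IsHermitian) (hρ1 : ρ.trace = 1) {s t : ℝ}
    (hst : s ≤ t) :
    chiSq (hsDual (semigroup 𝓛 t) ρ) σ ≤
      Real.exp (-2 * gap * (t - s)) * chiSq (hsDual (semigroup 𝓛 s) ρ) σ := by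
  set y := fun s => chiSq (hsDual (semigroup 𝓛 s) ρ) σ
  have hd : ∀ u, HasDerivAt (fun u => Real.exp (2 * gap * u) * y u)
      (Real.exp (2 * gap * u) * (2 * gap * y u
        - 2 * dirichlet₂ 𝓛 σ (gam σ (-1) (hsDual (semigroup 𝓛 u) ρ - σ)))) u := fun u => by
    have h1 := (((hasDerivAt_id u).const_mul (2 * gap)).exp).mul (hasDerivAt_chiSq hσ hL h hρ u)
    refine h1.congr_deriv ?_
    simp only [id, y]
    ring
  have hanti : Antitone fun u => Real.exp (2 * gap * u) * y u := by
    refine antitone_of_deriv_nonpos (fun u => (hd u).differentiableAt) fun u => ?_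
    rw [(hd u).deriv]
    refine mul_nonpos_of_nonneg_of_nonpos (Real.exp_pos _).le ?_
    have htr : (hsDual (semigroup 𝓛 u) ρ - σ).trace = 0 := by
      rw [Matrix.trace_sub, trace_hsDual_semigroup hL, hρ1, hσ1, sub_self]
    have h2 := spectralGap_mul_wVar_le hσ hσ1 hL h hα hgap
      (isHermitian_gam (σ := σ) ((isHermitian_hsDual_semigroup hL hρ u).sub hσ.1) (-1))
    rw [wVar_gam_neg_one hσ htr] at h2
    have : y u = ((hsDual (semigroup 𝓛 u) ρ - σ) *
      gam σ (-1) (hsDual (semigroup 𝓛 u) ρ - σ)).trace.re := rfl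
    rw [← this] at h2
    linarith
  have h3 := hanti hst
  simp only at h3
  have h4 : Real.exp (-2 * gap * (t - s)) = Real.exp (2 * gap * s) * (Real.exp (2 * gap * t))⁻¹ := by
    rw [← Real.exp_neg, ← Real.exp_add]
    ring_nf
  rw [h4, mul_right_comm, ← div_eq_mul_inv, le_div_iff₀ (Real.exp_pos _), mul_comm]
  exact h3

end Decay

/-! ### Traces of real powers: convexity, tangents and monotonicity -/

section Powers

variable {d : ℕ} {σ X Y : Mat d}

/-- The matrix with the eigenvectors of a Hermitian matrix and prescribed eigenvalues. -/
noncomputable def spectralLin {A : Mat d} (hA : A.IsHermitian) : (Fin d → ℝ) →ₗ[ℝ] Mat d where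
  toFun v := hA.eigenvectorUnitary.1 * diagonal (fun i => (v i : ℂ)) * star hA.eigenvectorUnitary.1
  map_add' v w := by
    rw [← Matrix.add_mul, ← Matrix.mul_add, Matrix.diagonal_add]
    simp
  map_smul' a v := by
    have : (diagonal fun i => ((a • v) i : ℂ) : Mat d) = a • diagonal fun i => (v i : ℂ) := by
      rw [← Matrix.diagonal_smul]
      congr 1
      ext i
      simp
    rw [this]
    simp

theorem cfc_eq_spectralLin {A : Mat d} (hA : A.IsHermitian) (f : ℝ → ℝ) :
    cfc f A = spectralLin hA fun i => f (hA.eigenvalues i) := by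
  rw [hA.cfc_eq, IsHermitian.cfc, Unitary.conjStarAlgAut_apply]
  rfl

theorem hasDerivAt_rpow_exponent (hσ : σ.PosDef) (s : ℝ) :
    HasDerivAt (fun s => rpow σ s) (logm σ * rpow σ s) s := by
  have e : logm σ * rpow σ s =
      spectralLin hσ.1 fun i => Real.log (hσ.1.eigenvalues i) * hσ.1.eigenvalues i ^ s := by
    rw [logm, rpow, cfc_mul_cfc, cfc_eq_spectralLin hσ.1]
  have e2 : (fun s => rpow σ s) = fun s => spectralLin hσ.1 fun i => hσ.1.eigenvalues i ^ s := by
    ext1 s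
    rw [rpow, cfc_eq_spectralLin hσ.1]
  rw [e, e2]
  refine hasDerivAt_linear_comp (spectralLin hσ.1) (hasDerivAt_pi.2 fun i => ?_)
  have := (hasDerivAt_id s).const_rpow (hσ.eigenvalues_pos i)
  simpa using this

theorem rpow_tangent_le {x y p : ℝ} (hx : 0 < x) (hy : 0 < y) (hp : 1 ≤ p) :
    p * (x ^ (p - 1) * (y - x)) ≤ y ^ p - x ^ p := by
  have h := one_add_mul_self_le_rpow_one_add (s := y / x - 1)
    (by have := div_pos hy hx; linarith) hp
  rw [add_sub_cancel, Real.div_rpow hy.le hx.le, le_div_iff₀ (Real.rpow_pos_of_pos hx p)] at h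
  have e : x ^ p = x ^ (p - 1) * x := by
    conv_lhs => rw [show p = (p - 1) + 1 by ring, Real.rpow_add_one hx.ne']
  have e2 : (1 + p * (y / x - 1)) * x ^ p = x ^ p + p * (x ^ (p - 1) * (y - x)) := by
    rw [e]
    field_simp
  linarith

/-- Convexity of $x\mapsto x^p$, applied at each pair of eigenvalues through `exists_weights`. It
stands in for the derivative of $\operatorname{tr}X^p$ in $X$. -/
theorem trace_rpow_tangent_le (hX : X.PosDef) (hY : Y.PosDef) {p : ℝ} (hp : 1 ≤ p) :
    p * (rpow X (p - 1) * (Y - X)).trace.re ≤ (rpow Y p).trace.re - (rpow X p).trace.re := by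
  obtain ⟨w, hw, hW⟩ := exists_weights hX.1 hY.1
  have h1 := hW (fun x => x ^ (p - 1)) (fun y => y)
  have h2 := hW (fun x => x ^ (p - 1) * x) (fun _ => 1)
  have h3 := hW (fun _ => 1) (fun y => y ^ p)
  have h4 := hW (fun x => x ^ p) (fun _ => 1)
  rw [cfc_id_eq hY.1] at h1
  rw [cfc_one_eq hY.1, Matrix.mul_one, ← cfc_mul_cfc, cfc_id_eq hX.1] at h2
  rw [cfc_one_eq hX.1, Matrix.one_mul] at h3
  rw [cfc_one_eq hY.1, Matrix.mul_one] at h4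
  rw [Matrix.mul_sub, Matrix.trace_sub, Complex.sub_re, rpow, rpow, rpow, h1, h2, h3, h4,
    ← Finset.sum_sub_distrib, ← Finset.sum_sub_distrib, Finset.mul_sum]
  refine Finset.sum_le_sum fun i _ => ?_
  rw [← Finset.sum_sub_distrib, ← Finset.sum_sub_distrib, Finset.mul_sum]
  refine Finset.sum_le_sum fun j _ => ?_
  have := mul_le_mul_of_nonneg_right
    (rpow_tangent_le (hX.eigenvalues_pos i) (hY.eigenvalues_pos j) hp) (hw i j)
  linarith

theorem trace_mul_le_sqrt {A B : Mat d} (hA : A.IsHermitian) (hB : B.IsHermitian) :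
    (A * B).trace.re ≤ Real.sqrt (A * A).trace.re * Real.sqrt (B * B).trace.re := by
  have h : ∀ c : ℝ, 0 ≤ (B * B).trace.re * (c * c) + (2 * (A * B).trace.re) * c
      + (A * A).trace.re := fun c => by
    have hc : (A + (c : ℂ) • B).IsHermitian := by
      rw [Complex.coe_smul]
      exact hA.add (hB.smul (IsSelfAdjoint.all _))
    refine (trace_mul_self_nonneg hc).trans_eq ?_
    simp only [Matrix.add_mul, Matrix.mul_add, Matrix.smul_mul, Matrix.mul_smul, Matrix.trace_add,
      Matrix.trace_smul, Complex.add_re, smul_eq_mul, Complex.re_ofReal_mul]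
    rw [Matrix.trace_mul_comm B A]
    ring
  have h2 := discrim_le_zero h
  rw [discrim] at h2
  rw [← Real.sqrt_mul (trace_mul_self_nonneg hA)]
  refine Real.le_sqrt_of_sq_le ?_
  linarith

theorem trace_rpow_mul_self_le (hX : X.PosDef) {r : ℝ} (hr : 0 ≤ r) :
    (rpow X r * rpow X r).trace.re ≤ d * (1 + X.trace.re) ^ (r + r) := by
  have htr : X.trace.re = ∑ i, hX.1.eigenvalues i := by
    rw [← trace_cfc_re hX.1 fun x => x, cfc_id_eq hX.1]
  rw [rpow_mul_rpow hX, rpow, trace_cfc_re hX.1]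
  have h : ∀ i, hX.1.eigenvalues i ^ (r + r) ≤ (1 + X.trace.re) ^ (r + r) := fun i => by
    refine Real.rpow_le_rpow (hX.eigenvalues_pos i).le ?_ (by linarith)
    rw [htr]
    have := Finset.single_le_sum (f := hX.1.eigenvalues) (fun i _ => (hX.eigenvalues_pos i).le)
      (Finset.mem_univ i)
    linarith
  simpa using Finset.sum_le_card_nsmul Finset.univ _ _ fun i _ => h i

/-- The base is frozen at $X(t)$, so only the exponent and a linear factor move and the derivative
is elementary. -/
theorem hasDerivAt_rpow_tangent {X : ℝ → Mat d} {X' : Mat d} {p : ℝ → ℝ} {p' t : ℝ}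
    (hXt : (X t).PosDef) (hX : HasDerivAt X X' t) (hp : HasDerivAt p p' t) :
    HasDerivAt (fun s => (rpow (X t) (p s)).trace.re
        + p s * (rpow (X t) (p s - 1) * (X s - X t)).trace.re)
      (p' * (rpow (X t) (p t) * logm (X t)).trace.re
        + p t * (rpow (X t) (p t - 1) * X').trace.re) t := by
  have h1 := hasDerivAt_linear_comp (reTrace d)
    ((hasDerivAt_rpow_exponent hXt (p t)).scomp t hp)
  have h2 := (hasDerivAt_rpow_exponent hXt (p t - 1)).scomp t (hp.sub_const 1)
  have h3 := hp.mul (hasDerivAt_trace_mul h2 (hX.sub_const (X t)))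
  refine (h1.add h3).congr_deriv ?_
  simp only [map_smul, smul_eq_mul, Function.comp_apply, sub_self,
    Matrix.trace_zero, Complex.zero_re, mul_zero, zero_add]
  rw [Matrix.trace_mul_comm (rpow (X t) (p t))]
  rfl

/-- A squeeze between the tangent at $X(t)$ from below and the tangent at $X(s)$ from above. The
latter is controlled by Cauchy–Schwarz and a locally bounded trace of $X(s)^{2(p-1)}$. -/
theorem continuousWithinAt_trace_rpow {X : ℝ → Mat d} {p : ℝ → ℝ} {t : ℝ} {S : Set ℝ}
    (hS : ∀ s ∈ S, (X s).PosDef) (ht : t ∈ S) (hp1 : ∀ s, 1 < p s) (hX : ContinuousAt X t)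
    (hp : ContinuousAt p t) :
    ContinuousWithinAt (fun s => (rpow (X s) (p s)).trace.re) S t := by
  have hre : Continuous fun A : Mat d => A.trace.re :=
    (LinearMap.toContinuousLinearMap (reTrace d)).continuous
  have hpow : ∀ r : ℝ → ℝ, ContinuousAt r t → ContinuousAt (fun s => rpow (X t) (r s)) t :=
    fun r hr => (hasDerivAt_rpow_exponent (hS t ht) (r t)).continuousAt.comp hr
  have hlow : ContinuousAt (fun s => (rpow (X t) (p s)).trace.re
        + p s * (rpow (X t) (p s - 1) * (X s - X t)).trace.re) t :=
    (hre.continuousAt.comp (hpow p hp)).add (hp.mul (hre.continuousAt.comp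
      ((hpow _ (hp.sub continuousAt_const)).mul (hX.sub continuousAt_const))))
  have htr0 : ∀ s ∈ S, 0 ≤ (X s).trace.re := fun s hs =>
    (Complex.le_def.1 (hS s hs).posSemidef.trace_nonneg).1
  have hbase : ContinuousAt (fun s => 1 + (X s).trace.re) t :=
    continuousAt_const.add (hre.continuousAt.comp hX)
  have hup : ContinuousAt (fun s => (rpow (X t) (p s)).trace.re
        + p s * (Real.sqrt (d * (1 + (X s).trace.re) ^ ((p s - 1) + (p s - 1)))
          * Real.sqrt ((X s - X t) * (X s - X t)).trace.re)) t :=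
    (hre.continuousAt.comp (hpow p hp)).add (hp.mul
      ((Real.continuous_sqrt.continuousAt.comp (continuousAt_const.mul
        (hbase.rpow ((hp.sub continuousAt_const).add (hp.sub continuousAt_const))
          (Or.inl (by have := htr0 t ht; positivity))))).mul
      (Real.continuous_sqrt.continuousAt.comp (hre.continuousAt.comp
        ((hX.sub continuousAt_const).mul (hX.sub continuousAt_const))))))
  have hl := hlow.continuousWithinAt (s := S) |>.tendsto
  have hu := hup.continuousWithinAt (s := S) |>.tendsto
  simp only [sub_self, Matrix.trace_zero, Complex.zero_re, mul_zero, add_zero,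
    Real.sqrt_zero] at hl hu
  refine tendsto_of_tendsto_of_tendsto_of_le_of_le' hl hu ?_ ?_
  · filter_upwards [self_mem_nhdsWithin] with s hs
    have := trace_rpow_tangent_le (hS t ht) (hS s hs) (hp1 s).le
    linarith
  · filter_upwards [self_mem_nhdsWithin] with s hs
    have h1 := trace_rpow_tangent_le (hS s hs) (hS t ht) (hp1 s).le
    have h2 := trace_mul_le_sqrt (isHermitian_rpow (X s) (p s - 1))
      ((hS s hs).1.sub (hS t ht).1)
    have h3 := Real.sqrt_le_sqrt
      (trace_rpow_mul_self_le (hS s hs) (r := p s - 1) (by linarith [hp1 s]))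
    have h4 := h2.trans (mul_le_mul_of_nonneg_right h3 (Real.sqrt_nonneg _))
    have h5 := mul_le_mul_of_nonneg_left h4 (show 0 ≤ p s by linarith [hp1 s])
    have h6 : (rpow (X s) (p s - 1) * (X t - X s)).trace.re =
        -(rpow (X s) (p s - 1) * (X s - X t)).trace.re := by
      rw [← neg_sub (X s), Matrix.mul_neg, Matrix.trace_neg, Complex.neg_re]
    rw [h6] at h1
    linarith

/-- For $s<t$ close to $t$, $F(s)\ge G(s)$ and $F(t)=G(t)$, so the left slopes of $F$ are at most
those of $G$, whose limit is nonpositive. -/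
theorem le_of_lower_tangent {F : ℝ → ℝ} {T : ℝ} (hT : 0 ≤ T)
    (hF : ContinuousOn F (Set.Icc 0 T))
    (h : ∀ t ∈ Set.Ioc 0 T, ∃ (G : ℝ → ℝ) (G' : ℝ), HasDerivAt G G' t ∧ G' ≤ 0 ∧ G t = F t ∧
      ∀ᶠ s in 𝓝[<] t, G s ≤ F s) : F T ≤ F 0 := by
  -- Reversing time turns left slopes of $F$ into right slopes of $u\mapsto-F(T-u)$.
  have key := image_le_of_liminf_slope_right_le_deriv_boundary (f := fun u => -F (T - u))
    (a := 0) (b := T) (B := fun _ => -F T) (B' := fun _ => 0)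
    (hF.comp (by fun_prop) (fun u hu => ⟨by linarith [hu.2], by linarith [hu.1]⟩)).neg
    (by simp) continuousOn_const (fun x _ => hasDerivWithinAt_const _ _ _) (fun x hx r hr => ?_)
  · have := key (Set.right_mem_Icc.2 hT)
    simp only [sub_self] at this
    linarith
  · obtain ⟨G, G', hG, hG0, hGF, hev⟩ := h (T - x) ⟨by linarith [hx.2], by linarith [hx.1]⟩
    have hd : HasDerivAt (fun u => -G (T - u)) G' x := by
      have := (hG.comp x ((hasDerivAt_id x).const_sub T)).neg
      refine this.congr_deriv ?_
      ring
    have h1 := (hasDerivAt_iff_tendsto_slope_left_right.1 hd).2.eventually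
      (gt_mem_nhds (lt_of_le_of_lt hG0 hr))
    have h2 : Tendsto (fun u => T - u) (𝓝[>] x) (𝓝[<] (T - x)) := by
      refine tendsto_nhdsWithin_iff.2 ⟨?_, ?_⟩
      · exact ((continuous_const.sub continuous_id).tendsto x).mono_left nhdsWithin_le_nhds
      · filter_upwards [self_mem_nhdsWithin] with u hu
        exact sub_lt_sub_left hu T
    refine Eventually.frequently ?_
    filter_upwards [h1, h2.eventually hev, self_mem_nhdsWithin] with z hz hz2 hzx
    refine lt_of_le_of_lt ?_ hz
    rw [slope_def_field, slope_def_field, hGF]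
    have : 0 < z - x := sub_pos.2 hzx
    gcongr

end Powers

/-! ### Hypercontractivity from the log-Sobolev inequality -/

section Hypercontractivity

variable {d : ℕ} {𝓛 : SuperOp d} {σ f : Mat d}

theorem hasDerivAt_gam_inv (hσ : σ.PosDef) {u : ℝ → Mat d} {u' : Mat d} {p : ℝ → ℝ} {p' t : ℝ}
    (hu : HasDerivAt u u' t) (hp : HasDerivAt p p' t) (hp0 : p t ≠ 0) :
    HasDerivAt (fun s => gam σ (1 / p s) (u s))
      (gam σ (1 / p t) u' - ((p' / (2 * p t ^ 2) : ℝ) : ℂ) •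
        (logm σ * gam σ (1 / p t) (u t) + gam σ (1 / p t) (u t) * logm σ)) t := by
  have he : HasDerivAt (fun s => 1 / p s / 2) (-(p' / (2 * p t ^ 2))) t := by
    have := (hp.inv hp0).div_const 2
    simp only [one_div]
    refine this.congr_deriv ?_
    field_simp
  have hr := (hasDerivAt_rpow_exponent hσ (1 / p t / 2)).scomp t he
  have hcomm : logm σ * rpow σ (1 / p t / 2) = rpow σ (1 / p t / 2) * logm σ := by
    rw [logm, rpow, cfc_mul_cfc, cfc_mul_cfc]
    simp only [mul_comm]
  have hcomm' : ∀ A, logm σ * (rpow σ (1 / p t / 2) * A) = rpow σ (1 / p t / 2) * (logm σ * A) :=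
    fun A => by rw [← Matrix.mul_assoc, hcomm, Matrix.mul_assoc]
  refine ((hr.mul hu).mul hr).congr_deriv ?_
  rw [Complex.coe_smul]
  simp only [gam, Pi.mul_apply, Function.comp_apply, Matrix.add_mul, Matrix.smul_mul, Matrix.mul_smul, neg_smul,
    Matrix.neg_mul, Matrix.mul_neg, smul_add, Matrix.mul_assoc, hcomm, hcomm']
  abel

/-- The derivative along the flow of `p⁻¹ log tr X^p` for `X = Γ^{1/p} (T_t f)` is nonpositive when
`p' = 2 α (p - 1)`. -/
theorem logDeriv_nonpos (hσ : σ.PosDef) (hreg : StronglyLpRegular 𝓛 σ) {α p : ℝ}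
    (hα : 0 < α) (hLS : ∀ f : Mat d, f.PosDef → α * ent₂ σ f ≤ dirichlet₂ 𝓛 σ f)
    (hp : 1 < p) (hf : f.PosDef) {X : Mat d} (hX : X = gam σ (1 / p) f) {p' : ℝ}
    (hp' : p' = 2 * α * (p - 1)) :
    p' * p * (rpow X p * logm X).trace.re + p ^ 2 * (rpow X (p - 1) * gam σ (1 / p) (𝓛 f)).trace.re
      - p' * (rpow X p * logm σ).trace.re
      - p' * (rpow X p).trace.re * Real.log (rpow X p).trace.re ≤ 0 := by
  have hp0 : 0 < p := by linarith
  have hp1 : 0 < p - 1 := by linarith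
  have hXp : X.PosDef := hX ▸ posDef_gam hσ hf _
  have hg : powerOp σ 2 p f = gam σ (-(1 / 2)) (rpow X (p / 2)) := by
    rw [powerOp, ← hX, absPow_eq_rpow hXp]
  have hgpos : (powerOp σ 2 p f).PosDef := hg ▸ posDef_gam hσ (posDef_rpow hXp _) _
  have hgam : gam σ (1 / 2) (powerOp σ 2 p f) = rpow X (p / 2) := by
    rw [hg, gam_gam_neg hσ]
  have hsq : rpow X (p / 2) * rpow X (p / 2) = rpow X p := by
    rw [rpow_mul_rpow hXp, add_halves]
  have hent : ent₂ σ (powerOp σ 2 p f) = p / 2 * (rpow X p * logm X).trace.re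
      - 1 / 2 * (rpow X p * logm σ).trace.re
      - 1 / 2 * (rpow X p).trace.re * Real.log (rpow X p).trace.re := by
    rw [ent₂, wNorm_two_sq hgpos.1, hgam, hsq, logm_rpow hXp, Matrix.mul_smul, Matrix.trace_smul,
      smul_eq_mul, Complex.re_ofReal_mul]
  have hdir : dirichlet 𝓛 σ p f =
      -p / (2 * (p - 1)) * (rpow X (p - 1) * gam σ (1 / p) (𝓛 f)).trace.re := by
    have e1 : p / (p / (p - 1)) = p - 1 := by field_simp
    have e2 : (1 : ℝ) + -(1 / (p / (p - 1))) = 1 / p := by field_simp; ring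
    rw [dirichlet, powerOp, ← hX, absPow_eq_rpow hXp, e1, wInner, gam_gam hσ, e2, trace_gam_mul]
  have h1 := hreg p hp f hf
  have h2 := hLS _ hgpos
  rw [hdir] at h1
  -- The chain $\frac2p\alpha\operatorname{Ent}_2(I_{2,p}f)\le\frac2p\mathcal
  -- E_2(I_{2,p}f)\le\mathcal E_p(f)$. Multiplied by $2p(p-1)$, it is the claim, because
  -- $p'=2\alpha(p-1)$.
  have h3 : 2 / p * (α * ent₂ σ (powerOp σ 2 p f)) ≤
      -p / (2 * (p - 1)) * (rpow X (p - 1) * gam σ (1 / p) (𝓛 f)).trace.re :=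
    (mul_le_mul_of_nonneg_left h2 (by positivity)).trans h1
  generalize (rpow X (p - 1) * gam σ (1 / p) (𝓛 f)).trace.re = k at *
  have h4 := mul_le_mul_of_nonneg_left h3 (show 0 ≤ 2 * p * (p - 1) by positivity)
  have e3 : 2 * p * (p - 1) * (-p / (2 * (p - 1)) * k) = -(p ^ 2 * k) := by field_simp
  have e4 : 2 * p * (p - 1) * (2 / p * (α * ent₂ σ (powerOp σ 2 p f))) =
      2 * p' * ent₂ σ (powerOp σ 2 p f) := by rw [hp']; field_simp
  rw [e3, e4, hent] at h4
  linarith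

/-- This is $\log\|T_Tf\|_{q,\sigma}\le\log\|f\|_{2,\sigma}$. The exponent solves $p'=2\alpha(p-1)$
with $p(0)=2$, which is what `logDeriv_nonpos` requires. -/
theorem hypercontractive (hσ : σ.PosDef) (hσ1 : σ.trace = 1) (hL : IsLiouvillian 𝓛)
    (hreg : StronglyLpRegular 𝓛 σ) {α : ℝ}
    (hα : 0 < α) (hLS : ∀ f : Mat d, f.PosDef → α * ent₂ σ f ≤ dirichlet₂ 𝓛 σ f)
    (hf : f.PosDef) {T : ℝ} (hT : 0 ≤ T) {q : ℝ} (hq : q = 1 + Real.exp (2 * α * T)) :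
    1 / q * Real.log (rpow (gam σ (1 / q) (semigroup 𝓛 T f)) q).trace.re ≤
      1 / 2 * Real.log (rpow (gam σ (1 / 2) f) 2).trace.re := by
  have := nonempty_of_trace_eq_one hσ1
  set p : ℝ → ℝ := fun t => 1 + Real.exp (2 * α * t) with hpdef
  have hp1 : ∀ t, 1 < p t := fun t => by
    have := Real.exp_pos (2 * α * t)
    simp only [hpdef]; linarith
  have hp0 : ∀ t, 0 < p t := fun t => by linarith [hp1 t]
  have hpd : ∀ t, HasDerivAt p (2 * α * (p t - 1)) t := fun t => by
    have := (((hasDerivAt_id t).const_mul (2 * α)).exp).const_add 1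
    refine this.congr_deriv ?_
    simp only [hpdef, id]; ring
  set X : ℝ → Mat d := fun t => gam σ (1 / p t) (semigroup 𝓛 t f) with hXdef
  have hXd := fun t => hasDerivAt_gam_inv hσ (hasDerivAt_semigroup 𝓛 f t) (hpd t) (hp0 t).ne'
  have hXpos : ∀ t, 0 ≤ t → (X t).PosDef := fun t ht => posDef_gam hσ (posDef_semigroup hL hf ht) _
  have hNpos : ∀ {t s : ℝ}, 0 ≤ t → 0 < (rpow (X t) s).trace.re := fun ht =>
    (Complex.lt_def.1 (posDef_rpow (hXpos _ ht) _).trace_pos).1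
  have main := le_of_lower_tangent (F := fun t => 1 / p t * Real.log (rpow (X t) (p t)).trace.re)
    hT ?_ ?_
  · have e0 : p 0 = 2 := by simp only [hpdef, mul_zero, Real.exp_zero]; norm_num
    have eT : p T = q := hq.symm
    simp only [hXdef, e0, eT, semigroup_zero, LinearMap.id_apply] at main
    exact main
  · intro t ht
    have h1 := continuousWithinAt_trace_rpow (S := Set.Icc 0 T) (fun s hs => hXpos s hs.1) ht hp1
      (hXd t).continuousAt (hpd t).continuousAt
    refine ContinuousWithinAt.mul ?_ (h1.log (hNpos ht.1).ne')
    exact (continuousAt_const.div (hpd t).continuousAt (hp0 t).ne').continuousWithinAt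
  · intro t ht
    have hψ := hasDerivAt_rpow_tangent (hXpos t ht.1.le) (hXd t) (hpd t)
    set ψ : ℝ → ℝ := fun s => (rpow (X t) (p s)).trace.re
        + p s * (rpow (X t) (p s - 1) * (X s - X t)).trace.re with hψdef
    have hψt : ψ t = (rpow (X t) (p t)).trace.re := by simp [hψdef]
    have hNt := hNpos (s := p t) ht.1.le
    have hψpos : 0 < ψ t := hψt ▸ hNt
    refine ⟨fun s => 1 / p s * Real.log (ψ s), _,
      ((hasDerivAt_const t (1 : ℝ)).div (hpd t) (hp0 t).ne').mul (hψ.log hψpos.ne'), ?_,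
      by simp only [hψt], ?_⟩
    · have key := logDeriv_nonpos hσ hreg hα hLS (hp1 t) (posDef_semigroup hL hf ht.1.le)
        (X := X t) rfl rfl
      -- By cyclicity of the trace, both orders of $\log\sigma$ and $X$ contribute the same
      -- $\operatorname{tr}(X^p\log\sigma)$.
      have hsplit : (rpow (X t) (p t - 1) * (gam σ (1 / p t) (𝓛 (semigroup 𝓛 t f)) -
          ((2 * α * (p t - 1) / (2 * p t ^ 2) : ℝ) : ℂ) •
            (logm σ * X t + X t * logm σ))).trace.re =
          (rpow (X t) (p t - 1) * gam σ (1 / p t) (𝓛 (semigroup 𝓛 t f))).trace.re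
            - 2 * α * (p t - 1) / p t ^ 2 * (rpow (X t) (p t) * logm σ).trace.re := by
        have hXt := hXpos t ht.1.le
        have hx : rpow (X t) (p t - 1) * X t = rpow (X t) (p t) := by
          have := rpow_mul_rpow hXt (p t - 1) 1
          rwa [rpow_one hXt, sub_add_cancel] at this
        have hx' : X t * rpow (X t) (p t - 1) = rpow (X t) (p t) := by
          have := rpow_mul_rpow hXt 1 (p t - 1)
          rwa [rpow_one hXt, add_sub_cancel] at this
        rw [Matrix.mul_sub, Matrix.mul_smul, Matrix.mul_add, Matrix.trace_sub, Matrix.trace_smul,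
          Matrix.trace_add, ← Matrix.mul_assoc, ← Matrix.mul_assoc, hx,
          Matrix.trace_mul_cycle, hx', Complex.sub_re, smul_eq_mul, Complex.re_ofReal_mul,
          Complex.add_re]
        field_simp
        ring
      simp only [hXdef] at hsplit key hψt hNt ⊢
      rw [hsplit, hψt]
      generalize (rpow (gam σ (1 / p t) (semigroup 𝓛 t f)) (p t)).trace.re = N at *
      refine (div_nonpos_of_nonpos_of_nonneg key (mul_pos hNt (pow_pos (hp0 t) 2)).le).trans_eq' ?_
      have := (hp0 t).ne'
      simp only [Pi.div_apply]
      field_simp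
      ring
    · have hev := hψ.continuousAt.eventually (lt_mem_nhds hψpos)
      filter_upwards [nhdsWithin_le_nhds hev, Ioo_mem_nhdsLT ht.1] with s hs hs2
      have h1 := trace_rpow_tangent_le (hXpos t ht.1.le) (hXpos s hs2.1.le) (hp1 s).le
      have h2 : ψ s ≤ (rpow (X s) (p s)).trace.re := by
        simp only [hψdef]; linarith
      exact mul_le_mul_of_nonneg_left (Real.log_le_log hs h2)
        (one_div_nonneg.2 (hp0 s).le)

end Hypercontractivity

end QMS

namespace QMS

open Matrix
open scoped ComplexOrder

/-! ### From hypercontractivity to a bound on the divergence -/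

section Mixing

variable {d : ℕ} {𝓛 : SuperOp d} {σ ρ : Mat d}

theorem posSemidef_gam {f : Mat d} (hf : f.PosSemidef) (r : ℝ) : (gam σ r f).PosSemidef := by
  have h := hf.mul_mul_conjTranspose_same (rpow σ (r / 2))
  rwa [(isHermitian_rpow σ (r / 2)).eq] at h

/-- `tr (A ρ) ≤ σ_min^{-1/q} ‖A‖_{q,σ}` for positive definite `A` and states `ρ`. -/
theorem trace_mul_state_le (hσ : σ.PosDef) (hρ : IsState ρ) {A : Mat d} (hA : A.PosDef) {q : ℝ}
    (hq : 0 < q) :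
    (A * ρ).trace.re ≤ (rpow (gam σ (1 / q) A) q).trace.re ^ (1 / q) *
      (1 / minEigenvalue σ) ^ (1 / q) := by
  have := nonempty_of_trace_eq_one hρ.2
  have hmin := minEigenvalue_pos hσ
  set X := gam σ (1 / q) A with hX
  have hXp : X.PosDef := posDef_gam hσ hA _
  set m := (rpow X q).trace.re ^ (1 / q)
  have hNeq : (rpow X q).trace.re = ∑ i, hXp.1.eigenvalues i ^ q := by
    rw [rpow, trace_cfc_re hXp.1]
  have hN0 : 0 ≤ (rpow X q).trace.re := (Complex.le_def.1 (posDef_rpow hXp q).posSemidef.trace_nonneg).1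
  have hm0 : 0 ≤ m := Real.rpow_nonneg hN0 _
  have hm : ∀ i, hXp.1.eigenvalues i ≤ m := fun i => by
    have h1 : hXp.1.eigenvalues i ^ q ≤ (rpow X q).trace.re := by
      rw [hNeq]
      exact Finset.single_le_sum (f := fun i => hXp.1.eigenvalues i ^ q)
        (fun i _ => Real.rpow_nonneg (hXp.eigenvalues_pos i).le _) (Finset.mem_univ i)
    have h2 := Real.rpow_le_rpow (Real.rpow_nonneg (hXp.eigenvalues_pos i).le _) h1
      (one_div_nonneg.2 hq.le)
    rwa [← Real.rpow_mul (hXp.eigenvalues_pos i).le, mul_one_div_cancel hq.ne', Real.rpow_one] at h2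
  -- From $X\le m$ follows $A\le m\,\sigma^{-1/q}$, and $\sigma^{-1/q}\le\sigma_{\min}^{-1/q}$.
  have h1 : ((m : ℂ) • 1 - X).PosSemidef := by
    rw [← cfc_const_sub hXp.1]
    exact posSemidef_cfc hXp.1 fun i => sub_nonneg.2 (hm i)
  have h2 := trace_mul_re_nonneg (posSemidef_gam (σ := σ) h1 (-(1 / q))) hρ.1
  rw [gam_sub, gam_smul, gam_one_right hσ, hX, gam_neg_gam hσ] at h2
  set c := (1 / minEigenvalue σ) ^ (1 / q) with hc
  have h3 : ((c : ℂ) • 1 - rpow σ (-(1 / q))).PosSemidef := by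
    have : (c : ℂ) • 1 - rpow σ (-(1 / q)) = cfc (fun x : ℝ => c - x ^ (-(1 / q))) σ := by
      rw [cfc_sub (fun _ => c) (fun x : ℝ => x ^ (-(1 / q))) σ (continuousOn_spectrum _ _)
        (continuousOn_spectrum _ _), cfc_const_eq hσ.1, rpow]
    rw [this]
    refine posSemidef_cfc hσ.1 fun i => sub_nonneg.2 ?_
    rw [hc, one_div (minEigenvalue σ), Real.inv_rpow hmin.le, ← Real.rpow_neg hmin.le]
    exact Real.rpow_le_rpow_of_nonpos hmin (minEigenvalue_le hσ.1 i)
      (by rw [neg_nonpos]; positivity)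
  have h4 := trace_mul_re_nonneg h3 hρ.1
  simp only [Matrix.sub_mul, Matrix.smul_mul, Matrix.one_mul, Matrix.trace_sub, Matrix.trace_smul,
    hρ.2, Complex.sub_re, smul_eq_mul, mul_one, Complex.re_ofReal_mul, Complex.ofReal_re] at h2 h4
  have h5 := mul_le_mul_of_nonneg_left (sub_nonneg.1 h4) hm0
  linarith

theorem chiSq_eq (hσ : σ.PosDef) (hσ1 : σ.trace = 1) (hρ1 : ρ.trace = 1) :
    chiSq ρ σ = (ρ * gam σ (-1) ρ).trace.re - 1 := by
  have h : gam σ (-1) σ = 1 := by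
    have := gam_neg_gam hσ 1 (1 : Mat d)
    rwa [gam_one_right hσ, rpow_one hσ] at this
  have h2 : (σ * gam σ (-1) ρ).trace = 1 := by
    rw [← trace_gam_mul, h, Matrix.one_mul, hρ1]
  simp only [chiSq, gam_sub, h, Matrix.sub_mul, Matrix.mul_sub, Matrix.mul_one, Matrix.trace_sub,
    h2, hσ1, hρ1, Complex.sub_re, Complex.one_re]
  ring

/-- The density $h=\Gamma_\sigma^{-1}(T_T^*\rho)$ is tested against its own state: moving $T_T$ onto
$h$ bounds $S=\|h\|_{2,\sigma}^2$ by $\sigma_{\min}^{-1/q}S^{1/2}$. -/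
theorem chiSq_le_of_posDef (hσ : σ.PosDef) (hσ1 : σ.trace = 1) (hL : IsLiouvillian 𝓛)
    (hreg : StronglyLpRegular 𝓛 σ) {α : ℝ}
    (hα : 0 < α) (hLS : ∀ f : Mat d, f.PosDef → α * ent₂ σ f ≤ dirichlet₂ 𝓛 σ f)
    (hρ : IsState ρ) {T : ℝ} (hT : 0 ≤ T) (hρT : (hsDual (semigroup 𝓛 T) ρ).PosDef) :
    chiSq (hsDual (semigroup 𝓛 T) ρ) σ ≤
      Real.exp (2 / (1 + Real.exp (2 * α * T)) * Real.log (1 / minEigenvalue σ)) := by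
  have := nonempty_of_trace_eq_one hσ1
  have hmin := minEigenvalue_pos hσ
  set q := 1 + Real.exp (2 * α * T) with hq
  have hq0 : 0 < q := by positivity
  set h := gam σ (-1) (hsDual (semigroup 𝓛 T) ρ) with hh
  have hpos : h.PosDef := posDef_gam hσ hρT _
  have hTpos := posDef_semigroup hL hpos hT
  rw [chiSq_eq hσ hσ1 (by rw [trace_hsDual_semigroup hL, hρ.2]), ← hh]
  have e1 : (hsDual (semigroup 𝓛 T) ρ * h).trace = (semigroup 𝓛 T h * ρ).trace := by
    rw [Matrix.trace_mul_comm, trace_hsDual_semigroup_mul hL hpos.1]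
  have e2 : (hsDual (semigroup 𝓛 T) ρ * h).trace.re =
      (rpow (gam σ (1 / 2) h) 2).trace.re := by
    rw [rpow_two (posDef_gam hσ hpos _), ← trace_gam_one_mul_self hσ, hh, gam_gam_neg hσ]
  have hhyp := hypercontractive hσ hσ1 hL hreg hα hLS hpos hT hq
  have hst := trace_mul_state_le hσ hρ hTpos hq0
  rw [← e1] at hst
  rw [← e2] at hhyp
  set S := (hsDual (semigroup 𝓛 T) ρ * h).trace.re
  have hS : 0 < S := by
    rw [e2]
    exact (Complex.lt_def.1 (posDef_rpow (posDef_gam hσ hpos _) _).trace_pos).1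
  have hN := (Complex.lt_def.1 (posDef_rpow (posDef_gam hσ hTpos (1 / q)) q).trace_pos).1
  have hlog := Real.log_le_log hS hst
  rw [Real.log_mul (Real.rpow_pos_of_pos hN _).ne'
    (Real.rpow_pos_of_pos (one_div_pos.2 hmin) _).ne', Real.log_rpow hN,
    Real.log_rpow (one_div_pos.2 hmin)] at hlog
  have hfin : Real.log S ≤ 2 / q * Real.log (1 / minEigenvalue σ) := by
    have : 2 / q * Real.log (1 / minEigenvalue σ) =
      2 * (1 / q * Real.log (1 / minEigenvalue σ)) := by ring
    rw [this]
    linarith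
  have := (Real.log_le_iff_le_exp hS).1 hfin
  linarith

theorem chiSq_le (hσ : σ.PosDef) (hσ1 : σ.trace = 1) (hL : IsLiouvillian 𝓛)
    (hstat : hsDual 𝓛 σ = 0) (hreg : StronglyLpRegular 𝓛 σ) {α : ℝ}
    (hα : 0 < α) (hLS : ∀ f : Mat d, f.PosDef → α * ent₂ σ f ≤ dirichlet₂ 𝓛 σ f)
    (hρ : IsState ρ) {T : ℝ} (hT : 0 ≤ T) :
    chiSq (hsDual (semigroup 𝓛 T) ρ) σ ≤
      Real.exp (2 / (1 + Real.exp (2 * α * T)) * Real.log (1 / minEigenvalue σ)) := by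
  set B := Real.exp (2 / (1 + Real.exp (2 * α * T)) * Real.log (1 / minEigenvalue σ))
  have key : ∀ ε ∈ Set.Ioo (0 : ℝ) 1,
      (1 - ε) ^ 2 * chiSq (hsDual (semigroup 𝓛 T) ρ) σ ≤ B := by
    intro ε hε
    -- Mixing with the stationary state makes the evolved state positive definite and multiplies
    -- $\chi^2$ by exactly $(1-\varepsilon)^2$.
    set ρ' : Mat d := ((1 - ε : ℝ) : ℂ) • ρ + (ε : ℂ) • σ with hρ'
    have hs : IsState ρ' := by
      refine ⟨(hρ.1.smul ?_).add (hσ.posSemidef.smul ?_), ?_⟩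
      · exact Complex.zero_le_real.2 (by linarith [hε.2])
      · exact Complex.zero_le_real.2 hε.1.le
      · rw [hρ', Matrix.trace_add, Matrix.trace_smul, Matrix.trace_smul, hρ.2, hσ1]
        simp
    have hev : hsDual (semigroup 𝓛 T) ρ' =
        ((1 - ε : ℝ) : ℂ) • hsDual (semigroup 𝓛 T) ρ + (ε : ℂ) • σ := by
      rw [hρ', map_add, map_smul, map_smul, hsDual_semigroup_stationary hstat]
    have hpd : (hsDual (semigroup 𝓛 T) ρ').PosDef := by
      rw [hev]
      refine Matrix.PosDef.posSemidef_add
        ((posSemidef_hsDual_semigroup hL hρ.1 hT).smul ?_) (hσ.smul ?_)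
      · exact Complex.zero_le_real.2 (by linarith [hε.2])
      · exact Complex.zero_lt_real.2 hε.1
    have h1 := chiSq_le_of_posDef hσ hσ1 hL hreg hα hLS hs hT hpd
    have h2 : chiSq (hsDual (semigroup 𝓛 T) ρ') σ =
        (1 - ε) ^ 2 * chiSq (hsDual (semigroup 𝓛 T) ρ) σ := by
      have e : hsDual (semigroup 𝓛 T) ρ' - σ =
          ((1 - ε : ℝ) : ℂ) • (hsDual (semigroup 𝓛 T) ρ - σ) := by
        rw [hev, smul_sub, Complex.ofReal_sub, sub_smul _ _ σ, Complex.ofReal_one, one_smul]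
        abel
      rw [chiSq, e, gam_smul, Matrix.smul_mul, Matrix.mul_smul, Matrix.trace_smul,
        Matrix.trace_smul, smul_eq_mul, smul_eq_mul, Complex.re_ofReal_mul, Complex.re_ofReal_mul,
        chiSq]
      ring
    rwa [h2] at h1
  have hlim : Filter.Tendsto (fun ε : ℝ => (1 - ε) ^ 2 * chiSq (hsDual (semigroup 𝓛 T) ρ) σ)
      (nhdsWithin 0 (Set.Ioi 0)) (nhds (chiSq (hsDual (semigroup 𝓛 T) ρ) σ)) := by
    have : Continuous fun ε : ℝ => (1 - ε) ^ 2 * chiSq (hsDual (semigroup 𝓛 T) ρ) σ := by fun_prop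
    have h := (this.tendsto 0).mono_left (nhdsWithin_le_nhds (s := Set.Ioi 0))
    simpa using h
  exact le_of_tendsto hlim (Filter.mem_of_superset (Ioo_mem_nhdsGT one_pos) key)

/-- In dimension one every variance vanishes, so the gap would be a minimum over the empty set. -/
theorem two_le_dim_of_isSpectralGap {gap : ℝ} (hσ : σ.PosDef) (hσ1 : σ.trace = 1)
    (hgap : IsSpectralGap 𝓛 σ gap) : 2 ≤ d := by
  have := nonempty_of_trace_eq_one hσ1
  have h0 := Fin.pos_iff_nonempty.2 this
  by_contra hd
  obtain rfl : d = 1 := by omega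
  obtain ⟨g, hg, hv, -⟩ := hgap.1
  apply hv
  have hσ' : σ = 1 := by
    ext i j
    obtain rfl := Subsingleton.elim i 0
    obtain rfl := Subsingleton.elim j 0
    simpa [Matrix.trace] using hσ1
  have h1 : ∀ r, rpow (1 : Mat 1) r = 1 := fun r => by
    rw [rpow, cfc_apply_one (R := ℝ)]
    simp
  have him : (g 0 0).im = 0 := by
    have := congrArg Complex.im (hg.apply 0 0)
    simp at this
    linarith
  rw [wVar, hσ', gam, h1]
  simp [Matrix.trace, Matrix.mul_apply, him]
  ring

/-- From $-\log l\le1/l-1$ the left side is at most $2/l-1-l$, and $2/l\le3$ exactly when $l\ge2/3$.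
-/
theorem neg_log_log_bound {l : ℝ} (hl : 2 / 3 ≤ l) : (2 + l) * -Real.log l ≤ 2 - l := by
  have h := Real.one_sub_inv_le_log_of_pos (show 0 < l by linarith)
  have h2 : (2 + l) * -Real.log l ≤ (2 + l) * (l⁻¹ - 1) :=
    mul_le_mul_of_nonneg_left (by linarith) (by linarith)
  refine h2.trans ?_
  have hl0 : 0 < l := by linarith
  have : (2 + l) * (l⁻¹ - 1) = 2 * l⁻¹ - 1 - l := by field_simp; ring
  rw [this]
  have : l⁻¹ ≤ 3 / 2 := by
    rw [inv_le_comm₀ hl0 (by norm_num)]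
    linarith
  linarith

end Mixing

end QMS

theorem proposition5p6 {d : ℕ} (𝓛 : QMS.SuperOp d) (σ : QMS.Mat d) (α₂ gap c t : ℝ)
    (hL : QMS.IsLiouvillian 𝓛) (hprim : QMS.IsPrimitive 𝓛 σ)
    (hreg : QMS.StronglyLpRegular 𝓛 σ)
    (hα : QMS.IsLogSobolevConst₂ 𝓛 σ α₂) (hgap : QMS.IsSpectralGap 𝓛 σ gap)
    (hc : 0 < c) (ht₀ : 0 ≤ t)
    (ht : 1 / (2 * α₂) * Real.log (Real.log (1 / QMS.minEigenvalue σ)) + c / gap ≤ t)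
    (ρ : QMS.Mat d) (hρ : QMS.IsState ρ) :
    QMS.chiSq (QMS.hsDual (QMS.semigroup 𝓛 t) ρ) σ ≤ Real.exp (2 * (1 - c)) := by
  obtain ⟨hσ, hσ1, hstat, -⟩ := hprim
  have := QMS.nonempty_of_trace_eq_one hσ1
  have hd := QMS.two_le_dim_of_isSpectralGap hσ hσ1 hgap
  have hα0 : 0 < α₂ := hα.1.1
  have hg0 := QMS.spectralGap_pos hσ hσ1 hL hstat hα hgap
  have hmin := QMS.minEigenvalue_pos hσ
  have hlog2 : Real.log 2 ≤ Real.log (1 / QMS.minEigenvalue σ) := by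
    refine Real.log_le_log two_pos ?_
    rw [le_div_iff₀ hmin]
    have h1 := QMS.dim_mul_minEigenvalue_le hσ.1 hσ1
    have h2 : (2 : ℝ) ≤ d := by exact_mod_cast hd
    nlinarith
  have hbound := fun {T : ℝ} (hT : 0 ≤ T) =>
    QMS.chiSq_le hσ hσ1 hL hstat hreg hα0 hα.1.2 hρ hT
  have hdecay := fun {s : ℝ} (hs : s ≤ t) =>
    QMS.chiSq_decay hσ hσ1 hL hstat hα hgap hρ.1.1 hρ.2 hs
  have hle := QMS.spectralGap_le hσ hσ1 hL hstat hα hgap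
    ((Real.log_pos one_lt_two).le.trans hlog2)
  set l := Real.log (1 / QMS.minEigenvalue σ)
  have hl : 2 / 3 ≤ l := by linarith [Real.log_two_gt_d9]
  have hl0 : 0 < l := by linarith
  rcases le_total 1 l with h1 | h1
  -- The time $s$ makes $q=1+l$, so $\chi^2\le e^{2l/(1+l)}\le e^2$. At least $c/\lambda$ remains
  -- for the decay.
  · set s := 1 / (2 * α₂) * Real.log l
    have hs0 : 0 ≤ s := mul_nonneg (by positivity) (Real.log_nonneg h1)
    have hcg : 0 ≤ c / gap := by positivity
    have he : Real.exp (2 * α₂ * s) = l := by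
      rw [show 2 * α₂ * s = Real.log l by simp only [s]; field_simp, Real.exp_log hl0]
    have hb := hbound hs0
    rw [he] at hb
    refine (hdecay (s := s) (by linarith)).trans
      ((mul_le_mul_of_nonneg_left hb (Real.exp_pos _).le).trans ?_)
    rw [← Real.exp_add, Real.exp_le_exp]
    have h2 : c ≤ gap * (t - s) := by
      rw [← div_le_iff₀' hg0]; linarith
    have h3 : 2 / (1 + l) * l ≤ 2 := by
      rw [div_mul_eq_mul_div, div_le_iff₀ (by linarith)]; linarith
    linarith
  -- Here $\log l\le0$. Starting from $\chi^2\le e^l$ at time $0$, the exponent is at most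
  -- $l-2c+\frac{\lambda}{\alpha_2}|\log l|$, and $\lambda/\alpha_2\le2+l$ bounds this by $2-2c$.
  · have hb := hbound le_rfl
    rw [mul_zero, Real.exp_zero, one_add_one_eq_two, div_self two_ne_zero, one_mul] at hb
    refine (hdecay (s := 0) ht₀).trans
      ((mul_le_mul_of_nonneg_left hb (Real.exp_pos _).le).trans ?_)
    rw [← Real.exp_add, Real.exp_le_exp]
    have h2 := mul_le_mul_of_nonneg_left ht hg0.le
    have h3 : gap * (c / gap) = c := by field_simp
    have h4 : gap / α₂ ≤ 2 + l := (div_le_iff₀ hα0).2 hle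
    have h5 := mul_le_mul_of_nonneg_right h4 (neg_nonneg.2 (Real.log_nonpos hl0.le h1))
    have h6 := QMS.neg_log_log_bound hl
    have h7 : gap * (1 / (2 * α₂) * Real.log l) = -(1 / 2 * (gap / α₂ * -Real.log l)) := by
      field_simp
    rw [mul_add, h3, h7] at h2
    linarith
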